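/- Let $n\in\mathbb N$, let $\varphi:\mathbb C^n\to\mathbb R$ be a $\mathcal C^2$-function, let $\eta\in\mathbb R$, and write $\partial_1,\dots,\partial_{2n}$ for the first order partial derivatives with respect to the real coordinates $x_1,\dots,x_n,y_1,\dots,y_n$ of $z_j=x_j+iy_j$. Suppose that for some $\epsilon>0$ $$\lim_{|z|\to\infty}\left(\eta^2|\nabla\varphi(z)|^2+(1+\epsilon)\,\eta\,\triangle\varphi(z)\right)=+\infty ,$$ where $|\nabla\varphi|^2=\sum_{k=1}^{2n}(\partial_k\varphi)^2$ and $\triangle\varphi=\sum_{k=1}^{2n}\partial_k^2\varphi$. Let $$W^1_\eta(\mathbb C^n,\nabla\varphi)=\left\{f\in L^2(\mathbb C^n)\ :\ \partial_kf-\tfrac{\eta}{2}(\partial_k\varphi)f\in L^2(\mathbb C^n),\ k=1,\dots,2n\right\},$$ where $\partial_kf$ is taken in the sense of distributions and $L^2$ is with respect to Lebesgue measure, endowed with the norm $$f\mapsto\left(\|f\|_{L^2}^2+\sum_{k=1}^{2n}\left\|\partial_kf-\tfrac{\eta}{2}(\partial_k\varphi)f\right\|_{L^2}^2\right)^{1/2}.$$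 Then the canonical embedding $\iota_\eta:W^1_\eta(\mathbb C^n,\nabla\varphi)\hookrightarrow L^2(\mathbb C^n)$ is compact. -/

import Mathlib

open MeasureTheory Filter Topology
open scoped ContDiff InnerProductSpace ENNReal

noncomputable section

namespace NablaSobolev

/-- `ℂⁿ` with its Euclidean norm; `volume` on it is the Lebesgue measure of `ℂⁿ ≅ ℝ²ⁿ`. -/
abbrev Cn (n : ℕ) : Type := EuclideanSpace ℂ (Fin n)

/-- The `2n` real coordinate directions of `ℂⁿ`: `inl j` is the direction of `x_j`, and `inr j` is
the direction of `y_j`, where `z_j = x_j + i y_j`. -/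
def dir {n : ℕ} : Fin n ⊕ Fin n → Cn n
  | Sum.inl j => EuclideanSpace.single j 1
  | Sum.inr j => EuclideanSpace.single j Complex.I

/-- The classical first order partial derivative `∂ₖ u` along the `k`-th real coordinate. -/
def partialDeriv {n : ℕ} {F : Type*} [NormedAddCommGroup F] [NormedSpace ℝ F]
    (k : Fin n ⊕ Fin n) (u : Cn n → F) (z : Cn n) : F :=
  fderiv ℝ u z (dir k)

/-- `h` is the partial derivative `∂ₖ f` of `f` in the sense of distributions
(`f` and `h` locally integrable). -/
structure HasWeakPartialDeriv {n : ℕ} (k : Fin n ⊕ Fin n) (f h : Cn n → ℂ) : Prop where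
  locallyIntegrable : LocallyIntegrable f volume
  locallyIntegrable_deriv : LocallyIntegrable h volume
  integral_eq : ∀ χ : Cn n → ℂ, ContDiff ℝ ∞ χ → HasCompactSupport χ →
    ∫ z, partialDeriv k χ z * f z = - ∫ z, χ z * h z

/-- The Hilbert space `L²(ℂⁿ)` of (classes of) complex-valued functions. -/
abbrev L2 (n : ℕ) : Type := Lp ℂ 2 (volume : Measure (Cn n))

/-- `∂ₖ f - (η / 2) (∂ₖ φ) f = g` in the sense of distributions. -/
def HasTwistedDeriv {n : ℕ} (φ : Cn n → ℝ) (η : ℝ) (k : Fin n ⊕ Fin n) (f g : L2 n) : Prop :=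
  HasWeakPartialDeriv k f (fun z => g z + ((η / 2 * partialDeriv k φ z : ℝ) : ℂ) * f z)

section Helpers

variable {n : ℕ}

theorem integrable_test_mul {f : Cn n → ℂ} (hf : LocallyIntegrable f volume) {χ : Cn n → ℂ}
    (hχ : Continuous χ) (hc : HasCompactSupport χ) : Integrable (fun z => χ z * f z) volume :=
  hf.integrable_smul_left_of_hasCompactSupport hχ hc

theorem continuous_partialDeriv {k : Fin n ⊕ Fin n} {χ : Cn n → ℂ} (hχ : ContDiff ℝ ∞ χ) :
    Continuous (partialDeriv k χ) :=
  (hχ.continuous_fderiv (by simp)).clm_apply continuous_const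

theorem hasCompactSupport_partialDeriv {k : Fin n ⊕ Fin n} {χ : Cn n → ℂ}
    (hc : HasCompactSupport χ) : HasCompactSupport (partialDeriv k χ) :=
  hc.fderiv_apply ℝ (dir k)

theorem HasWeakPartialDeriv.congr {k : Fin n ⊕ Fin n} {f f' h h' : Cn n → ℂ}
    (H : HasWeakPartialDeriv k f h) (hf : f =ᵐ[volume] f') (hh : h =ᵐ[volume] h') :
    HasWeakPartialDeriv k f' h' where
  locallyIntegrable := H.locallyIntegrable.congr hf
  locallyIntegrable_deriv := H.locallyIntegrable_deriv.congr hh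
  integral_eq χ hχ hc := by
    have h1 : ∫ z, partialDeriv k χ z * f' z = ∫ z, partialDeriv k χ z * f z :=
      integral_congr_ae (hf.mono fun z hz => by simp only [hz])
    have h2 : ∫ z, χ z * h' z = ∫ z, χ z * h z :=
      integral_congr_ae (hh.mono fun z hz => by simp only [hz])
    rw [h1, h2, H.integral_eq χ hχ hc]

theorem HasWeakPartialDeriv.zero (k : Fin n ⊕ Fin n) :
    HasWeakPartialDeriv k (fun _ => 0) (fun _ => 0) where
  locallyIntegrable := locallyIntegrable_zero
  locallyIntegrable_deriv := locallyIntegrable_zero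
  integral_eq χ _ _ := by simp

theorem HasWeakPartialDeriv.add {k : Fin n ⊕ Fin n} {f₁ f₂ h₁ h₂ : Cn n → ℂ}
    (H₁ : HasWeakPartialDeriv k f₁ h₁) (H₂ : HasWeakPartialDeriv k f₂ h₂) :
    HasWeakPartialDeriv k (f₁ + f₂) (h₁ + h₂) where
  locallyIntegrable := H₁.locallyIntegrable.add H₂.locallyIntegrable
  locallyIntegrable_deriv := H₁.locallyIntegrable_deriv.add H₂.locallyIntegrable_deriv
  integral_eq χ hχ hc := by
    have hd := continuous_partialDeriv (k := k) hχ
    have hdc := hasCompactSupport_partialDeriv (k := k) hc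
    simp only [Pi.add_apply, mul_add]
    rw [integral_add (integrable_test_mul H₁.locallyIntegrable hd hdc)
        (integrable_test_mul H₂.locallyIntegrable hd hdc),
      integral_add (integrable_test_mul H₁.locallyIntegrable_deriv hχ.continuous hc)
        (integrable_test_mul H₂.locallyIntegrable_deriv hχ.continuous hc),
      H₁.integral_eq χ hχ hc, H₂.integral_eq χ hχ hc]
    ring

theorem HasWeakPartialDeriv.const_smul {k : Fin n ⊕ Fin n} {f h : Cn n → ℂ}
    (H : HasWeakPartialDeriv k f h) (c : ℂ) : HasWeakPartialDeriv k (c • f) (c • h) where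
  locallyIntegrable := H.locallyIntegrable.smul c
  locallyIntegrable_deriv := H.locallyIntegrable_deriv.smul c
  integral_eq χ hχ hc := by
    simp only [Pi.smul_apply, smul_eq_mul, mul_left_comm _ c]
    rw [integral_const_mul, integral_const_mul, H.integral_eq χ hχ hc]
    ring

theorem HasWeakPartialDeriv.unique {k : Fin n ⊕ Fin n} {f h h' : Cn n → ℂ}
    (H : HasWeakPartialDeriv k f h) (H' : HasWeakPartialDeriv k f h') : h =ᵐ[volume] h' := by
  refine ae_eq_of_integral_contDiff_smul_eq H.locallyIntegrable_deriv H'.locallyIntegrable_deriv ?_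
  intro χ hχ hc
  have hχ' : ContDiff ℝ ∞ (fun z => (χ z : ℂ)) := Complex.ofRealCLM.contDiff.comp hχ
  have hc' : HasCompactSupport (fun z => (χ z : ℂ)) :=
    hc.comp_left (g := fun x : ℝ => (x : ℂ)) Complex.ofReal_zero
  have e := (H.integral_eq _ hχ' hc').symm.trans (H'.integral_eq _ hχ' hc')
  simpa only [Complex.real_smul] using neg_injective e

variable {φ : Cn n → ℝ} {η : ℝ} {k : Fin n ⊕ Fin n}

theorem HasTwistedDeriv.zero : HasTwistedDeriv φ η k 0 0 := by
  refine (HasWeakPartialDeriv.zero k).congr (Lp.coeFn_zero ℂ 2 volume).symm ?_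
  filter_upwards [Lp.coeFn_zero ℂ 2 (volume : Measure (Cn n))] with z hz
  simp

theorem HasTwistedDeriv.add {f₁ f₂ g₁ g₂ : L2 n} (H₁ : HasTwistedDeriv φ η k f₁ g₁)
    (H₂ : HasTwistedDeriv φ η k f₂ g₂) : HasTwistedDeriv φ η k (f₁ + f₂) (g₁ + g₂) := by
  refine (HasWeakPartialDeriv.add H₁ H₂).congr (Lp.coeFn_add f₁ f₂).symm ?_
  filter_upwards [Lp.coeFn_add f₁ f₂, Lp.coeFn_add g₁ g₂] with z hf hg
  simp only [hf, hg, Pi.add_apply]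
  ring

theorem HasTwistedDeriv.smul {f g : L2 n} (H : HasTwistedDeriv φ η k f g) (c : ℂ) :
    HasTwistedDeriv φ η k (c • f) (c • g) := by
  refine (HasWeakPartialDeriv.const_smul H c).congr (Lp.coeFn_smul c f).symm ?_
  filter_upwards [Lp.coeFn_smul c f, Lp.coeFn_smul c g] with z hf hg
  simp only [hf, hg, Pi.smul_apply, smul_eq_mul]
  ring

theorem HasTwistedDeriv.unique {f g g' : L2 n} (H : HasTwistedDeriv φ η k f g)
    (H' : HasTwistedDeriv φ η k f g') : g = g' := by
  refine Lp.ext ?_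
  filter_upwards [HasWeakPartialDeriv.unique H H'] with z hz
  exact add_right_cancel hz

end Helpers

/-- The linear subspace
`{f ∈ L²(ℂⁿ) : ∂ₖ f - (η / 2) (∂ₖ φ) f ∈ L²(ℂⁿ) for all 2n coordinates k}` of `L²(ℂⁿ)`. -/
def sobolevSubmodule {n : ℕ} (φ : Cn n → ℝ) (η : ℝ) : Submodule ℂ (L2 n) where
  carrier := {f | ∀ k, ∃ g : L2 n, HasTwistedDeriv φ η k f g}
  zero_mem' _ := ⟨0, HasTwistedDeriv.zero⟩
  add_mem' hf hg k := by
    obtain ⟨f', hf'⟩ := hf k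
    obtain ⟨g', hg'⟩ := hg k
    exact ⟨f' + g', hf'.add hg'⟩
  smul_mem' c _ hf k := by
    obtain ⟨f', hf'⟩ := hf k
    exact ⟨c • f', hf'.smul c⟩

/-- The space `W¹_η(ℂⁿ, ∇φ)`. This is a type synonym of `sobolevSubmodule φ η`, as it carries its own
norm (see `W1.norm_eq`) and not the one of `L²(ℂⁿ)`. -/
def W1 {n : ℕ} (φ : Cn n → ℝ) (η : ℝ) : Type := sobolevSubmodule φ η

namespace W1

variable {n : ℕ} {φ : Cn n → ℝ} {η : ℝ}

instance : AddCommGroup (W1 φ η) := inferInstanceAs (AddCommGroup (sobolevSubmodule φ η))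

instance : Module ℂ (W1 φ η) := inferInstanceAs (Module ℂ (sobolevSubmodule φ η))

/-- The inclusion `W¹_η(ℂⁿ, ∇φ) → L²(ℂⁿ)` as a linear map. -/
def toL2 : W1 φ η →ₗ[ℂ] L2 n := (sobolevSubmodule φ η).subtype

theorem exists_hasTwistedDeriv (f : W1 φ η) (k : Fin n ⊕ Fin n) :
    ∃ g : L2 n, HasTwistedDeriv φ η k (toL2 f) g :=
  f.2 k

/-- The operator `f ↦ ∂ₖ f - (η / 2) (∂ₖ φ) f` from `W¹_η(ℂⁿ, ∇φ)` to `L²(ℂⁿ)`. -/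
def twistedDeriv (k : Fin n ⊕ Fin n) : W1 φ η →ₗ[ℂ] L2 n where
  toFun f := (exists_hasTwistedDeriv f k).choose
  map_add' f g := (exists_hasTwistedDeriv (f + g) k).choose_spec.unique
    ((exists_hasTwistedDeriv f k).choose_spec.add (exists_hasTwistedDeriv g k).choose_spec)
  map_smul' c f := (exists_hasTwistedDeriv (c • f) k).choose_spec.unique
    ((exists_hasTwistedDeriv f k).choose_spec.smul c)

theorem hasTwistedDeriv (f : W1 φ η) (k : Fin n ⊕ Fin n) :
    HasTwistedDeriv φ η k (toL2 f) (twistedDeriv k f) :=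
  (exists_hasTwistedDeriv f k).choose_spec

/-- The map `f ↦ (f, (∂ₖ f - (η / 2) (∂ₖ φ) f)ₖ)` into the Hilbert sum of `1 + 2n` copies of
`L²(ℂⁿ)`, from which `W¹_η(ℂⁿ, ∇φ)` gets its norm. -/
def graphMap : W1 φ η →ₗ[ℂ] PiLp 2 (fun _ : Option (Fin n ⊕ Fin n) => L2 n) :=
  (WithLp.linearEquiv 2 ℂ (Option (Fin n ⊕ Fin n) → L2 n)).symm.toLinearMap ∘ₗ
    LinearMap.pi (fun o => o.elim toL2 twistedDeriv)

theorem graphMap_injective : Function.Injective (graphMap (φ := φ) (η := η)) := by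
  intro f g h
  have h0 : toL2 f = toL2 g := congrArg (fun u => u.ofLp none) h
  exact Subtype.ext h0

instance : NormedAddCommGroup (W1 φ η) :=
  NormedAddCommGroup.induced (W1 φ η) (PiLp 2 (fun _ : Option (Fin n ⊕ Fin n) => L2 n))
    graphMap graphMap_injective

instance : NormedSpace ℂ (W1 φ η) :=
  NormedSpace.induced ℂ (W1 φ η) (PiLp 2 (fun _ : Option (Fin n ⊕ Fin n) => L2 n)) graphMap

/-- The norm of `W¹_η(ℂⁿ, ∇φ)`. -/
theorem norm_eq (f : W1 φ η) :
    ‖f‖ = √(‖toL2 f‖ ^ 2 + ∑ k, ‖twistedDeriv k f‖ ^ 2) := by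
  change ‖graphMap f‖ = _
  rw [PiLp.norm_eq_of_L2, Fintype.sum_option]
  rfl

/-- The canonical embedding `ι_η : W¹_η(ℂⁿ, ∇φ) → L²(ℂⁿ)`. -/
def embedding (φ : Cn n → ℝ) (η : ℝ) : W1 φ η →L[ℂ] L2 n :=
  toL2.mkContinuous 1 (fun f => by
    rw [one_mul, norm_eq]
    exact Real.le_sqrt_of_sq_le (le_add_of_nonneg_right (by positivity)))

end W1

end NablaSobolev

end

noncomputable section

namespace NablaSobolev

/-! It suffices that the image of the unit ball of `W1` is totally bounded in L². This follows from
uniformly small tails together with compactness on balls.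

Tails: put a_k = (η/2) ∂_k φ, let G = χ f be a compactly supported cutoff of f, and let s_k = ∂_k G
- a_k G. Integration by parts gives 2 ∫ a_k Re⟨G, ∂_k G⟩ = -∫ (∂_k a_k) |G|². Hence ∫ (4 a_k² +
2(1+ε) ∂_k a_k) |G|² equals 4‖a_k G‖² - 4(1+ε) Re⟨a_k G, s_k + a_k G⟩, and completing the square
bounds this by (2 + ε + 1/ε) ‖s_k‖² (`four_mul_norm_sq_le`, `integral_weight_le`). Summed over k,
the coefficient of |G|² is exactly the function assumed to tend to +∞ (`weight_eq`). It is bounded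
below and exceeds any given N off a large ball, so little L² mass of f lies there, uniformly over
the unit ball (`exists_norm_sub_cutoff_le`).

Balls: each a_k is bounded on compact sets, so cutoffs of the unit ball are bounded in the ordinary
H¹ (`exists_localized_bounds`) and Rellich's theorem applies
(`totallyBounded_of_weakDeriv_bounded`). Rellich holds because an H¹ bound makes mollification
uniformly close to the identity, while mollification followed by restriction to a ball is
Hilbert–Schmidt. -/

theorem eLpNorm_two_sq {α F : Type*} [MeasurableSpace α] [NormedAddCommGroup F] (P : Measure α)
    (h : α → F) : eLpNorm h 2 P ^ 2 = ∫⁻ t, ‖h t‖ₑ ^ 2 ∂P := by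
  simpa using eLpNorm_nnreal_pow_eq_lintegral (f := h) (μ := P) (p := 2) (by norm_num)

/-! ### Mollification by a normalized bump, viewed as averaging over translations. -/

section Mollification

open scoped Convolution

variable {E F : Type*} [NormedAddCommGroup E] [NormedSpace ℝ E] [FiniteDimensional ℝ E]
  [HasContDiffBump E] [MeasurableSpace E] [BorelSpace E] {μ : Measure E} [μ.IsAddHaarMeasure]
  [NormedAddCommGroup F] [NormedSpace ℝ F]

variable (μ) in
/-- The convolution of `g` with the normalized bump function `ρ`. -/
def mollify (ρ : ContDiffBump (0 : E)) (g : E → F) : E → F :=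
  ρ.normed μ ⋆[ContinuousLinearMap.lsmul ℝ ℝ, μ] g

theorem integrable_bump_smul (ρ : ContDiffBump (0 : E)) {g : E → F} (hg : LocallyIntegrable g μ)
    (z : E) : Integrable (fun t => ρ.normed μ t • g (z - t)) μ :=
  (ρ.hasCompactSupport_normed (μ := μ)).convolutionExists_left (L := ContinuousLinearMap.lsmul ℝ ℝ)
    ρ.continuous_normed hg z

/-- The probability measure with density a normalized bump function. -/
def bumpMeasure (μ : Measure E) (ρ : ContDiffBump (0 : E)) : Measure E :=
  μ.withDensity fun t => ENNReal.ofReal (ρ.normed μ t)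

instance (ρ : ContDiffBump (0 : E)) : IsProbabilityMeasure (bumpMeasure μ ρ) where
  measure_univ := by
    rw [bumpMeasure, withDensity_apply _ MeasurableSet.univ, Measure.restrict_univ,
      ← ofReal_integral_eq_lintegral_ofReal ρ.integrable_normed
        (Eventually.of_forall ρ.nonneg_normed), ρ.integral_normed, ENNReal.ofReal_one]

theorem measurable_bump (ρ : ContDiffBump (0 : E)) :
    Measurable fun t => ENNReal.ofReal (ρ.normed μ t) :=
  (ρ.continuous_normed (μ := μ)).measurable.ennreal_ofReal

theorem ae_bumpMeasure_norm_lt (ρ : ContDiffBump (0 : E)) :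
    ∀ᵐ t ∂bumpMeasure μ ρ, ‖t‖ < ρ.rOut := by
  rw [bumpMeasure, ae_withDensity_iff (measurable_bump ρ)]
  refine Eventually.of_forall fun t ht => ?_
  have h : t ∈ Function.support (ρ.normed μ) := fun h0 => ht (by simp [h0])
  rw [ρ.support_normed_eq] at h
  simpa using h

theorem integral_bumpMeasure (ρ : ContDiffBump (0 : E)) (h : E → F) :
    ∫ t, h t ∂bumpMeasure μ ρ = ∫ t, ρ.normed μ t • h t ∂μ := by
  rw [bumpMeasure, integral_withDensity_eq_integral_toReal_smul (measurable_bump ρ)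
    (Eventually.of_forall fun _ => ENNReal.ofReal_lt_top)]
  simp [ENNReal.toReal_ofReal (ρ.nonneg_normed _)]

theorem mollify_sub_eq [CompleteSpace F] (ρ : ContDiffBump (0 : E)) {g : E → F}
    (hg : LocallyIntegrable g μ) (z : E) :
    mollify μ ρ g z - g z = ∫ t, (g (z - t) - g z) ∂bumpMeasure μ ρ := by
  rw [integral_bumpMeasure, mollify, convolution_lsmul]
  simp only [smul_sub]
  rw [integral_sub (integrable_bump_smul ρ hg z) (ρ.integrable_normed.smul_const _),
    integral_smul_const, ρ.integral_normed, one_smul]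

/-- Jensen's inequality: on a probability space the L¹ norm is at most the L² norm. -/
theorem enorm_integral_sq_le {α : Type*} [MeasurableSpace α] (P : Measure α)
    [IsProbabilityMeasure P] {h : α → F} (hh : AEStronglyMeasurable h P) :
    ‖∫ t, h t ∂P‖ₑ ^ 2 ≤ ∫⁻ t, ‖h t‖ₑ ^ 2 ∂P := by
  have h1 : ‖∫ t, h t ∂P‖ₑ ≤ eLpNorm h 2 P := by
    refine (enorm_integral_le_lintegral_enorm h).trans ?_
    rw [← eLpNorm_one_eq_lintegral_enorm]
    exact eLpNorm_le_eLpNorm_of_exponent_le (by norm_num) hh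
  rw [← eLpNorm_two_sq]
  gcongr

/-- Mollifying at scale `rOut` moves a function in `L²` by at most its `L²` modulus of
continuity. -/
theorem eLpNorm_mollify_sub_le [CompleteSpace F] (ρ : ContDiffBump (0 : E)) {g : E → F}
    (hg : LocallyIntegrable g μ) (hm : StronglyMeasurable g) {C : ℝ≥0∞}
    (hC : ∀ t, ‖t‖ < ρ.rOut → eLpNorm (fun z => g (z - t) - g z) 2 μ ≤ C) :
    eLpNorm (fun z => mollify μ ρ g z - g z) 2 μ ≤ C := by
  have hm2 : StronglyMeasurable fun p : E × E => g (p.1 - p.2) - g p.1 :=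
    (hm.comp_measurable (measurable_fst.sub measurable_snd)).sub (hm.comp_measurable measurable_fst)
  -- After squaring, Jensen in t and Tonelli reduce the claim to the bound for each single
  -- translation.
  rw [← ENNReal.pow_le_pow_left_iff (two_ne_zero), eLpNorm_two_sq]
  calc ∫⁻ z, ‖mollify μ ρ g z - g z‖ₑ ^ 2 ∂μ
      ≤ ∫⁻ z, ∫⁻ t, ‖g (z - t) - g z‖ₑ ^ 2 ∂bumpMeasure μ ρ ∂μ := by
        refine lintegral_mono fun z => ?_
        rw [mollify_sub_eq ρ hg]
        exact enorm_integral_sq_le _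
          (hm2.comp_measurable measurable_prodMk_left).aestronglyMeasurable
    _ = ∫⁻ t, ∫⁻ z, ‖g (z - t) - g z‖ₑ ^ 2 ∂μ ∂bumpMeasure μ ρ :=
        lintegral_lintegral_swap (hm2.enorm.pow_const 2).aemeasurable
    _ ≤ ∫⁻ _, C ^ 2 ∂bumpMeasure μ ρ := by
        refine lintegral_mono_ae ((ae_bumpMeasure_norm_lt ρ).mono fun t ht => ?_)
        rw [← eLpNorm_two_sq]
        gcongr
        exact hC t ht
    _ = C ^ 2 := by simp

theorem contDiff_mollify [CompleteSpace F] (ρ : ContDiffBump (0 : E)) {g : E → F}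
    (hg : LocallyIntegrable g μ) : ContDiff ℝ ∞ (mollify μ ρ g) :=
  (ρ.hasCompactSupport_normed).contDiff_convolution_left _ ρ.contDiff_normed hg

/-- The derivative is put on the bump, so that the integral can be read as a weak derivative tested
against w ↦ ρ(z - w). -/
theorem fderiv_mollify_apply [CompleteSpace F] (ρ : ContDiffBump (0 : E)) {g : E → F}
    (hg : LocallyIntegrable g μ) (z v : E) :
    fderiv ℝ (mollify μ ρ g) z v = ∫ w, fderiv ℝ (ρ.normed μ) (z - w) v • g w ∂μ := by
  have h := (ρ.hasCompactSupport_normed (μ := μ)).hasFDerivAt_convolution_left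
    (ContinuousLinearMap.lsmul ℝ ℝ) (ρ.contDiff_normed (n := 1)) hg z
  have hc : HasCompactSupport (fderiv ℝ (ρ.normed μ)) :=
    (ρ.hasCompactSupport_normed (μ := μ)).fderiv ℝ
  have hi := hc.convolutionExists_left ((ContinuousLinearMap.lsmul ℝ ℝ).precompL E)
    ((ρ.contDiff_normed (n := 1)).continuous_fderiv (by simp)) hg z
  rw [show fderiv ℝ (mollify μ ρ g) z = _ from h.fderiv, convolution_eq_swap,
    ContinuousLinearMap.integral_apply hi.integrable_swap]
  rfl

end Mollification

/-! ### Translations and mollification on L², and smooth approximation in H¹. -/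

section Translation

variable {n : ℕ}

/-- Translation by `t` on `L²(ℂⁿ)`. -/
def translate (t : Cn n) (G : L2 n) : L2 n :=
  Lp.compMeasurePreserving (fun z => z - t) (measurePreserving_sub_right volume t) G

theorem coeFn_translate (t : Cn n) (G : L2 n) : translate t G =ᵐ[volume] fun z => G (z - t) :=
  Lp.coeFn_compMeasurePreserving G (measurePreserving_sub_right volume t)

theorem norm_translate (t : Cn n) (G : L2 n) : ‖translate t G‖ = ‖G‖ :=
  Lp.norm_compMeasurePreserving G (measurePreserving_sub_right volume t)

theorem translate_zero (G : L2 n) : translate 0 G = G := by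
  refine Lp.ext ((coeFn_translate 0 G).trans ?_)
  simp

theorem continuous_translate_left (G : L2 n) : Continuous fun t => translate t G :=
  Continuous.compMeasurePreservingLp (f := fun _ => G) continuous_const
    (g := fun t : Cn n => (⟨fun z => z - t, by fun_prop⟩ : C(Cn n, Cn n)))
    (ContinuousMap.curry ⟨fun p : Cn n × Cn n => p.2 - p.1, by fun_prop⟩).continuous
    (fun t => measurePreserving_sub_right volume t) (by norm_num)

theorem continuous_translate_right (t : Cn n) : Continuous fun G : L2 n => translate t G :=
  (Lp.isometry_compMeasurePreserving (measurePreserving_sub_right volume t)).continuous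

theorem eLpNorm_translate_sub (t : Cn n) (G : L2 n) :
    eLpNorm (fun z => G (z - t) - G z) 2 volume = ENNReal.ofReal ‖translate t G - G‖ := by
  rw [Lp.norm_def, ENNReal.ofReal_toReal (Lp.eLpNorm_ne_top _)]
  refine eLpNorm_congr_ae ?_
  filter_upwards [coeFn_translate t G, Lp.coeFn_sub (translate t G) G] with z h1 h2
  rw [h2, Pi.sub_apply, h1]

theorem locallyIntegrable_coe (G : L2 n) : LocallyIntegrable G (volume : Measure (Cn n)) :=
  (Lp.memLp G).locallyIntegrable (by norm_num)

theorem memLp_mollify (ρ : ContDiffBump (0 : Cn n)) (G : L2 n) :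
    MemLp (mollify volume ρ G) 2 (volume : Measure (Cn n)) := by
  have hs : AEStronglyMeasurable (mollify volume ρ G) (volume : Measure (Cn n)) :=
    (contDiff_mollify ρ (locallyIntegrable_coe G)).continuous.aestronglyMeasurable
  have h : MemLp (fun z => mollify volume ρ G z - G z) 2 (volume : Measure (Cn n)) := by
    refine ⟨hs.sub (Lp.aestronglyMeasurable G), ?_⟩
    -- The crude modulus of continuity 2‖G‖ suffices for membership in L².
    refine (eLpNorm_mollify_sub_le ρ (locallyIntegrable_coe G) (Lp.stronglyMeasurable G)
      (C := ENNReal.ofReal (2 * ‖G‖)) fun t _ => ?_).trans_lt ENNReal.ofReal_lt_top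
    rw [eLpNorm_translate_sub]
    refine ENNReal.ofReal_le_ofReal ((norm_sub_le _ _).trans ?_)
    rw [norm_translate, two_mul]
  convert h.add (Lp.memLp G) using 1
  ext z
  simp

/-- Mollification on `L²(ℂⁿ)`. -/
def mollifyLp (ρ : ContDiffBump (0 : Cn n)) (G : L2 n) : L2 n := (memLp_mollify ρ G).toLp _

theorem coeFn_mollifyLp (ρ : ContDiffBump (0 : Cn n)) (G : L2 n) :
    mollifyLp ρ G =ᵐ[volume] mollify volume ρ G := MemLp.coeFn_toLp _

theorem norm_mollifyLp_sub_le (ρ : ContDiffBump (0 : Cn n)) (G : L2 n) {C : ℝ} (hC0 : 0 ≤ C)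
    (hC : ∀ t, ‖t‖ < ρ.rOut → ‖translate t G - G‖ ≤ C) : ‖mollifyLp ρ G - G‖ ≤ C := by
  have h := eLpNorm_mollify_sub_le ρ (locallyIntegrable_coe G) (Lp.stronglyMeasurable G)
      (C := ENNReal.ofReal C) fun t ht => by
        rw [eLpNorm_translate_sub]
        exact ENNReal.ofReal_le_ofReal (hC t ht)
  rw [Lp.norm_def]
  refine ENNReal.toReal_le_of_le_ofReal hC0 (le_trans (le_of_eq ?_) h)
  refine eLpNorm_congr_ae ?_
  filter_upwards [coeFn_mollifyLp ρ G, Lp.coeFn_sub (mollifyLp ρ G) G] with z h1 h2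
  rw [h2, Pi.sub_apply, h1]

theorem tendsto_mollifyLp {ι : Type*} {l : Filter ι} {ρ : ι → ContDiffBump (0 : Cn n)}
    (hρ : Tendsto (fun i => (ρ i).rOut) l (𝓝 0)) (G : L2 n) :
    Tendsto (fun i => mollifyLp (ρ i) G) l (𝓝 G) := by
  rw [Metric.tendsto_nhds]
  intro ε hε
  have h0 : Tendsto (fun t => translate t G) (𝓝 0) (𝓝 G) := by
    simpa [translate_zero] using (continuous_translate_left G).tendsto 0
  obtain ⟨δ, hδ, h⟩ := Metric.eventually_nhds_iff.1 (Metric.tendsto_nhds.1 h0 (ε / 2) (half_pos hε))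
  filter_upwards [hρ.eventually (gt_mem_nhds hδ)] with i hi
  rw [dist_eq_norm]
  refine (norm_mollifyLp_sub_le _ _ (half_pos hε).le fun t ht => ?_).trans_lt (half_lt_self hε)
  rw [← dist_eq_norm]
  exact (h (by simpa using ht.trans hi)).le

/-- The test function is w ↦ ρ(z - w): the sign from differentiating z - w cancels the sign in the
definition of the weak derivative. -/
theorem HasWeakPartialDeriv.partialDeriv_mollify {k : Fin n ⊕ Fin n} {g h : Cn n → ℂ}
    (H : HasWeakPartialDeriv k g h) (ρ : ContDiffBump (0 : Cn n)) :
    partialDeriv k (mollify volume ρ g) = mollify volume ρ h := by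
  ext z
  set χ : Cn n → ℂ := fun w => (ρ.normed volume (z - w) : ℂ) with hχdef
  have hχ : ContDiff ℝ ∞ χ :=
    Complex.ofRealCLM.contDiff.comp (ρ.contDiff_normed.comp (contDiff_const.sub contDiff_id))
  have hc : HasCompactSupport χ :=
    (ρ.hasCompactSupport_normed.comp_homeomorph (Homeomorph.subLeft z)).comp_left
      (g := fun x : ℝ => (x : ℂ)) Complex.ofReal_zero
  have hd : ∀ w, partialDeriv k χ w = -(fderiv ℝ (ρ.normed volume) (z - w) (dir k) : ℂ) := by
    intro w
    have h1 : HasFDerivAt (ρ.normed volume) (fderiv ℝ (ρ.normed volume) (z - w)) (z - w) :=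
      ((ρ.contDiff_normed (n := 1)).differentiable (by simp) _).hasFDerivAt
    have h2 := Complex.ofRealCLM.hasFDerivAt.comp w
      (h1.comp w ((hasFDerivAt_id w).const_sub z))
    rw [partialDeriv, show fderiv ℝ χ w = _ from h2.fderiv]
    simp
  have e := H.integral_eq χ hχ hc
  simp only [hd, neg_mul, integral_neg, neg_inj] at e
  rw [partialDeriv, fderiv_mollify_apply ρ H.locallyIntegrable, mollify,
    convolution_eq_swap]
  simpa [Complex.real_smul, hχdef] using e

/-- Meyers–Serrin: a function in the Sobolev space `H¹` is a limit in `H¹` of smooth functions. -/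
theorem exists_smooth_approx {G : L2 n} {H : Fin n ⊕ Fin n → L2 n}
    (hGH : ∀ k, HasWeakPartialDeriv k G (H k)) :
    ∃ (u : ℕ → Cn n → ℂ) (U : ℕ → L2 n) (V : Fin n ⊕ Fin n → ℕ → L2 n),
      (∀ m, ContDiff ℝ ∞ (u m)) ∧ (∀ m, U m =ᵐ[volume] u m) ∧
      (∀ k m, V k m =ᵐ[volume] partialDeriv k (u m)) ∧ Tendsto U atTop (𝓝 G) ∧
      ∀ k, Tendsto (V k) atTop (𝓝 (H k)) := by
  let ρ : ℕ → ContDiffBump (0 : Cn n) := fun m =>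
    ⟨1 / ((m : ℝ) + 1) / 2, 1 / ((m : ℝ) + 1), by positivity, half_lt_self (by positivity)⟩
  have hρ : Tendsto (fun m => (ρ m).rOut) atTop (𝓝 0) := tendsto_one_div_add_atTop_nhds_zero_nat
  refine ⟨fun m => mollify volume (ρ m) G, fun m => mollifyLp (ρ m) G,
    fun k m => mollifyLp (ρ m) (H k), fun m => contDiff_mollify _ (locallyIntegrable_coe G),
    fun m => coeFn_mollifyLp _ _, fun k m => ?_, tendsto_mollifyLp hρ G,
    fun k => tendsto_mollifyLp hρ (H k)⟩
  rw [(hGH k).partialDeriv_mollify]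
  exact coeFn_mollifyLp _ _

end Translation

/-! ### Multiplication operators with continuous compactly supported symbol. -/

section Multiplication

variable {n : ℕ}

theorem memLp_mul_of_bound {b : Cn n → ℝ} (hb : Continuous b) {C : ℝ} (hC : ∀ z, |b z| ≤ C)
    (f : L2 n) : MemLp (fun z => (b z : ℂ) * f z) 2 (volume : Measure (Cn n)) := by
  refine (Lp.memLp f).of_le_mul (c := C)
    ((Complex.continuous_ofReal.comp hb).aestronglyMeasurable.mul (Lp.aestronglyMeasurable f))
    (Eventually.of_forall fun z => ?_)
  rw [norm_mul, Complex.norm_real, Real.norm_eq_abs]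
  gcongr
  exact hC z

theorem exists_abs_le {b : Cn n → ℝ} (hb : Continuous b) (hc : HasCompactSupport b) :
    ∃ C, 0 ≤ C ∧ ∀ z, |b z| ≤ C := by
  obtain ⟨C, hC⟩ := hc.exists_bound_of_continuous hb
  exact ⟨C, (norm_nonneg _).trans (hC 0), hC⟩

theorem memLp_mul {b : Cn n → ℝ} (hb : Continuous b) (hc : HasCompactSupport b) (f : L2 n) :
    MemLp (fun z => (b z : ℂ) * f z) 2 (volume : Measure (Cn n)) :=
  memLp_mul_of_bound hb (exists_abs_le hb hc).choose_spec.2 f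

/-- Multiplication by a continuous compactly supported function, as an operator on `L²(ℂⁿ)`. -/
def mulL (b : Cn n → ℝ) (hb : Continuous b) (hc : HasCompactSupport b) : L2 n →L[ℂ] L2 n :=
  LinearMap.mkContinuous
    { toFun := fun f => (memLp_mul hb hc f).toLp _
      map_add' := fun f g => by
        refine Lp.ext ?_
        refine (MemLp.coeFn_toLp _).trans (EventuallyEq.trans ?_ (Lp.coeFn_add _ _).symm)
        filter_upwards [Lp.coeFn_add f g,
          (memLp_mul hb hc f).coeFn_toLp,
          (memLp_mul hb hc g).coeFn_toLp]
          with z h1 h2 h3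
        rw [Pi.add_apply, h1, h2, h3, Pi.add_apply, mul_add]
      map_smul' := fun c f => by
        refine Lp.ext ?_
        refine (MemLp.coeFn_toLp _).trans (EventuallyEq.trans ?_ (Lp.coeFn_smul _ _).symm)
        filter_upwards [Lp.coeFn_smul c f,
          (memLp_mul hb hc f).coeFn_toLp]
          with z h1 h2
        simp only [Pi.smul_apply, h1, h2, smul_eq_mul, RingHom.id_apply]
        ring } (exists_abs_le hb hc).choose fun f => by
    refine Lp.norm_le_mul_norm_of_ae_le_mul ?_
    filter_upwards [(memLp_mul hb hc f).coeFn_toLp] with z h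
    change ‖((memLp_mul hb hc f).toLp _ : L2 n) z‖ ≤ _
    rw [h, norm_mul, Complex.norm_real, Real.norm_eq_abs]
    gcongr
    exact (exists_abs_le hb hc).choose_spec.2 z

variable {b : Cn n → ℝ} (hb : Continuous b) (hc : HasCompactSupport b)

theorem coeFn_mulL (f : L2 n) : mulL b hb hc f =ᵐ[volume] fun z => (b z : ℂ) * f z :=
  (memLp_mul hb hc f).coeFn_toLp

theorem norm_mulL_le {C : ℝ} (hC : ∀ z, |b z| ≤ C) (f : L2 n) : ‖mulL b hb hc f‖ ≤ C * ‖f‖ := by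
  refine Lp.norm_le_mul_norm_of_ae_le_mul ?_
  filter_upwards [coeFn_mulL hb hc f] with z h
  rw [h, norm_mul, Complex.norm_real, Real.norm_eq_abs]
  gcongr
  exact hC z

theorem inner_mulL (f g : L2 n) :
    ⟪mulL b hb hc f, g⟫_ℝ = ∫ z, b z * ⟪f z, g z⟫_ℝ := by
  rw [L2.inner_def]
  refine integral_congr_ae ?_
  filter_upwards [coeFn_mulL hb hc f] with z h
  rw [h, ← Complex.real_smul, real_inner_smul_left]

end Multiplication

/-! ### Integration by parts and translation estimates for smooth functions. -/

section Smooth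

variable {n : ℕ}

theorem continuous_fderiv_apply_const {F : Type*} [NormedAddCommGroup F] [NormedSpace ℝ F]
    {u : Cn n → F} (hu : ContDiff ℝ 1 u) (v : Cn n) :
    Continuous fun z => fderiv ℝ u z v :=
  (hu.continuous_fderiv (by simp)).clm_apply continuous_const

/-- Integration by parts of `b` against |u|², whose derivative is 2 Re⟨u, ∂u⟩. The compact support
of `b` supplies integrability, so `u` needs no decay. -/
theorem integral_mul_inner_fderiv {b : Cn n → ℝ} (hb : ContDiff ℝ 1 b)
    (hc : HasCompactSupport b) {u : Cn n → ℂ} (hu : ContDiff ℝ 1 u) (v : Cn n) :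
    2 * ∫ z, b z * ⟪u z, fderiv ℝ u z v⟫_ℝ = -∫ z, fderiv ℝ b z v * ⟪u z, u z⟫_ℝ := by
  have hq : ContDiff ℝ 1 fun z => ⟪u z, u z⟫_ℝ := hu.inner ℝ hu
  have hqd : ∀ z, fderiv ℝ (fun z => ⟪u z, u z⟫_ℝ) z v = 2 * ⟪u z, fderiv ℝ u z v⟫_ℝ := by
    intro z
    have hd : DifferentiableAt ℝ u z := hu.differentiable (by simp) z
    rw [fderiv_inner_apply ℝ hd hd, real_inner_comm, two_mul]
  have key := integral_mul_fderiv_eq_neg_fderiv_mul_of_integrable (μ := (volume : Measure (Cn n)))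
    (f := b) (g := fun z => ⟪u z, u z⟫_ℝ) (v := v)
    (((continuous_fderiv_apply_const hb v).mul hq.continuous).integrable_of_hasCompactSupport
      (hc.fderiv_apply ℝ v).mul_right)
    ((hb.continuous.mul (continuous_fderiv_apply_const hq v)).integrable_of_hasCompactSupport
      hc.mul_right)
    ((hb.continuous.mul hq.continuous).integrable_of_hasCompactSupport hc.mul_right)
    (fun z _ => hb.differentiable (by simp) z) (fun z _ => hq.differentiable (by simp) z)
  rw [← key, ← integral_const_mul]
  congr 1
  ext z
  rw [hqd]
  ring

/-- The fundamental theorem of calculus on the segment from z to z - t writes the difference as an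
average of directional derivatives; Jensen, Tonelli and translation invariance finish. -/
theorem eLpNorm_sub_translate_le {u : Cn n → ℂ} (hu : ContDiff ℝ 1 u) (t : Cn n) :
    eLpNorm (fun z => u (z - t) - u z) 2 volume ≤ eLpNorm (fun z => fderiv ℝ u z t) 2 volume := by
  have hcont : Continuous fun z => fderiv ℝ u z t := continuous_fderiv_apply_const hu t
  have hftc : ∀ z, u (z - t) - u z
      = ∫ s, -fderiv ℝ u (z - s • t) t ∂(volume.restrict (Set.Ioc (0 : ℝ) 1)) := by
    intro z
    have hd : ∀ s ∈ Set.uIcc (0 : ℝ) 1,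
        HasDerivAt (fun s : ℝ => u (z - s • t)) (-fderiv ℝ u (z - s • t) t) s := by
      intro s _
      have h1 : HasDerivAt (fun s : ℝ => z - s • t) (-t) s := by
        simpa using ((hasDerivAt_id s).smul_const t).const_sub z
      have h2 := ((hu.differentiable (by simp) (z - s • t)).hasFDerivAt).comp_hasDerivAt s h1
      simpa [Function.comp_def] using h2
    have hi : IntervalIntegrable (fun s : ℝ => -fderiv ℝ u (z - s • t) t) volume 0 1 :=
      (hcont.comp (by fun_prop : Continuous fun s : ℝ => z - s • t)).neg.intervalIntegrable _ _
    have h := intervalIntegral.integral_eq_sub_of_hasDerivAt hd hi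
    rw [intervalIntegral.integral_of_le zero_le_one] at h
    rw [h]
    simp
  have : IsProbabilityMeasure ((volume : Measure ℝ).restrict (Set.Ioc (0 : ℝ) 1)) :=
    ⟨by simp⟩
  have hc2 : Continuous fun p : Cn n × ℝ => -fderiv ℝ u (p.1 - p.2 • t) t :=
    (hcont.comp (by fun_prop : Continuous fun p : Cn n × ℝ => p.1 - p.2 • t)).neg
  rw [← ENNReal.pow_le_pow_left_iff two_ne_zero, eLpNorm_two_sq, eLpNorm_two_sq]
  calc ∫⁻ z, ‖u (z - t) - u z‖ₑ ^ 2
      ≤ ∫⁻ z, ∫⁻ s, ‖-fderiv ℝ u (z - s • t) t‖ₑ ^ 2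
          ∂(volume.restrict (Set.Ioc (0 : ℝ) 1)) := by
        refine lintegral_mono fun z => ?_
        rw [hftc]
        exact enorm_integral_sq_le _
          (hc2.comp (by fun_prop : Continuous fun s : ℝ => (z, s))).aestronglyMeasurable
    _ = ∫⁻ s, ∫⁻ z, ‖-fderiv ℝ u (z - s • t) t‖ₑ ^ 2
          ∂volume ∂(volume.restrict (Set.Ioc (0 : ℝ) 1)) :=
        lintegral_lintegral_swap (hc2.measurable.enorm.pow_const 2).aemeasurable
    _ = ∫⁻ _, ∫⁻ z, ‖fderiv ℝ u z t‖ₑ ^ 2 ∂volume ∂(volume.restrict (Set.Ioc (0 : ℝ) 1)) := by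
        refine lintegral_congr fun s => ?_
        simp only [enorm_neg]
        exact lintegral_sub_right_eq_self (fun z => ‖fderiv ℝ u z t‖ₑ ^ 2) (s • t)
    _ = ∫⁻ z, ‖fderiv ℝ u z t‖ₑ ^ 2 := by simp

/-- The real coordinates of a vector of `ℂⁿ`. -/
def realCoord (t : Cn n) : Fin n ⊕ Fin n → ℝ :=
  Sum.elim (fun j => (t j).re) (fun j => (t j).im)

theorem sum_realCoord_smul_dir (t : Cn n) : ∑ k, realCoord t k • dir k = t := by
  ext j
  simp only [Fintype.sum_sum_type, realCoord, Sum.elim_inl, Sum.elim_inr, dir]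
  simp only [PiLp.add_apply, WithLp.ofLp_sum, Finset.sum_apply, PiLp.smul_apply]
  simp

theorem abs_realCoord_le (t : Cn n) (k : Fin n ⊕ Fin n) : |realCoord t k| ≤ ‖t‖ := by
  rcases k with j | j
  · exact (Complex.abs_re_le_norm _).trans (PiLp.norm_apply_le t j)
  · exact (Complex.abs_im_le_norm _).trans (PiLp.norm_apply_le t j)

theorem fderiv_apply_eq_sum_partialDeriv {F : Type*} [NormedAddCommGroup F] [NormedSpace ℝ F]
    (u : Cn n → F) (z t : Cn n) : fderiv ℝ u z t = ∑ k, realCoord t k • partialDeriv k u z := by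
  conv_lhs => rw [← sum_realCoord_smul_dir t, map_sum]
  simp [partialDeriv]

end Smooth

/-! ### Extension to weak derivatives by density, and the Leibniz rule. -/

section WeakDerivatives

variable {n : ℕ} {G : L2 n} {H : Fin n ⊕ Fin n → L2 n}

theorem norm_translate_sub_le_of_smooth {u : Cn n → ℂ} (hu : ContDiff ℝ 1 u) {U : L2 n}
    {V : Fin n ⊕ Fin n → L2 n} (hU : U =ᵐ[volume] u)
    (hV : ∀ k, V k =ᵐ[volume] partialDeriv k u) (t : Cn n) :
    ‖translate t U - U‖ ≤ ‖t‖ * ∑ k, ‖V k‖ := by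
  have h1 : ‖translate t U - U‖ ≤ ‖∑ k, realCoord t k • V k‖ := by
    rw [Lp.norm_def, Lp.norm_def]
    refine ENNReal.toReal_mono (Lp.eLpNorm_ne_top _) ?_
    have hL : (translate t U - U : L2 n) =ᵐ[volume] fun z => u (z - t) - u z := by
      filter_upwards [Lp.coeFn_sub (translate t U) U, coeFn_translate t U, hU,
        (measurePreserving_sub_right volume t).quasiMeasurePreserving.ae_eq_comp hU] with z a b c d
      rw [a, Pi.sub_apply, b, c]
      simpa using d
    have hR : (∑ k, realCoord t k • V k : L2 n) =ᵐ[volume] fun z => fderiv ℝ u z t := by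
      have hs : ∀ᵐ z, ∀ k, (realCoord t k • V k : L2 n) z = realCoord t k • partialDeriv k u z :=
        ae_all_iff.2 fun k => by
          filter_upwards [Lp.coeFn_smul (realCoord t k) (V k), hV k] with z a b
          rw [a, Pi.smul_apply, b]
      filter_upwards [Lp.coeFn_finsetSum (Finset.univ) fun k => realCoord t k • V k, hs] with z a b
      rw [a, fderiv_apply_eq_sum_partialDeriv, Finset.sum_apply]
      exact Finset.sum_congr rfl fun k _ => b k
    rw [eLpNorm_congr_ae hL, eLpNorm_congr_ae hR]
    exact eLpNorm_sub_translate_le hu t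
  refine h1.trans ((norm_sum_le _ _).trans ?_)
  rw [Finset.mul_sum]
  refine Finset.sum_le_sum fun k _ => ?_
  rw [norm_smul, Real.norm_eq_abs]
  gcongr
  exact abs_realCoord_le t k

theorem norm_translate_sub_le (hGH : ∀ k, HasWeakPartialDeriv k G (H k)) (t : Cn n) :
    ‖translate t G - G‖ ≤ ‖t‖ * ∑ k, ‖H k‖ := by
  obtain ⟨u, U, V, hu, hU, hV, hUG, hVH⟩ := exists_smooth_approx hGH
  refine le_of_tendsto_of_tendsto'
    ((((continuous_translate_right t).tendsto G).comp hUG).sub hUG).norm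
    (tendsto_const_nhds.mul (tendsto_finsetSum _ fun k _ => (hVH k).norm)) fun m => ?_
  exact norm_translate_sub_le_of_smooth ((hu m).of_le (by exact_mod_cast le_top)) (hU m)
    (fun k => hV k m) t

theorem norm_mollifyLp_sub_le_mul (hGH : ∀ k, HasWeakPartialDeriv k G (H k))
    (ρ : ContDiffBump (0 : Cn n)) : ‖mollifyLp ρ G - G‖ ≤ ρ.rOut * ∑ k, ‖H k‖ := by
  have hs : 0 ≤ ∑ k, ‖H k‖ := Finset.sum_nonneg fun k _ => norm_nonneg _
  refine norm_mollifyLp_sub_le ρ G (mul_nonneg ρ.rOut_pos.le hs) fun t ht => ?_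
  exact (norm_translate_sub_le hGH t).trans (by gcongr)

/-- The identity `∫ b ∂ₖ|G|² = -∫ (∂ₖ b) |G|²` for `G` in the Sobolev space `H¹`. -/
theorem two_mul_integral_inner_weakDeriv (hGH : ∀ k, HasWeakPartialDeriv k G (H k))
    {b : Cn n → ℝ} (hb : ContDiff ℝ 1 b) (hc : HasCompactSupport b) (k : Fin n ⊕ Fin n) :
    2 * ∫ z, b z * ⟪G z, H k z⟫_ℝ = -∫ z, partialDeriv k b z * ⟪G z, G z⟫_ℝ := by
  have hb' : Continuous (partialDeriv k b) := continuous_fderiv_apply_const hb (dir k)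
  have hc' : HasCompactSupport (partialDeriv k b) := hc.fderiv_apply ℝ (dir k)
  obtain ⟨u, U, V, hu, hU, hV, hUG, hVH⟩ := exists_smooth_approx hGH
  -- Written as inner products of bounded operators applied to the approximants, both sides are
  -- continuous in L², so the smooth identity passes to the limit.
  have hm : ∀ m, 2 * ⟪mulL b hb.continuous hc (U m), V k m⟫_ℝ
      = -⟪mulL (partialDeriv k b) hb' hc' (U m), U m⟫_ℝ := by
    intro m
    rw [inner_mulL, inner_mulL]
    have e1 : ∫ z, b z * ⟪U m z, V k m z⟫_ℝ = ∫ z, b z * ⟪u m z, fderiv ℝ (u m) z (dir k)⟫_ℝ := by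
      refine integral_congr_ae ?_
      filter_upwards [hU m, hV k m] with z h1 h2
      rw [h1, h2, partialDeriv]
    have e2 : ∫ z, partialDeriv k b z * ⟪U m z, U m z⟫_ℝ
        = ∫ z, fderiv ℝ b z (dir k) * ⟪u m z, u m z⟫_ℝ := by
      refine integral_congr_ae ?_
      filter_upwards [hU m] with z h1
      rw [h1, partialDeriv]
    rw [e1, e2]
    exact integral_mul_inner_fderiv hb hc ((hu m).of_le (by exact_mod_cast le_top)) (dir k)
  rw [← inner_mulL hb.continuous hc, ← inner_mulL hb' hc']
  exact tendsto_nhds_unique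
    (((((mulL b hb.continuous hc).continuous.tendsto G).comp hUG).inner (hVH k)).const_mul 2)
    ((((((mulL _ hb' hc').continuous.tendsto G).comp hUG).inner hUG).neg).congr
      fun m => (hm m).symm)

/-- The Leibniz rule for the product with a smooth function. -/
theorem HasWeakPartialDeriv.smooth_mul {k : Fin n ⊕ Fin n} {f h : Cn n → ℂ}
    (W : HasWeakPartialDeriv k f h) {χ : Cn n → ℝ} (hχ : ContDiff ℝ ∞ χ) :
    HasWeakPartialDeriv k (fun z => (χ z : ℂ) * f z)
      (fun z => (χ z : ℂ) * h z + ((partialDeriv k χ z : ℝ) : ℂ) * f z) := by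
  have hχ' : ContDiff ℝ ∞ fun z => (χ z : ℂ) := Complex.ofRealCLM.contDiff.comp hχ
  have hd : Continuous fun z => ((partialDeriv k χ z : ℝ) : ℂ) :=
    Complex.continuous_ofReal.comp (continuous_fderiv_apply_const (hχ.of_le (by simp)) (dir k))
  have hmul : ∀ {c : Cn n → ℂ} {g : Cn n → ℂ}, Continuous c → LocallyIntegrable g volume →
      LocallyIntegrable (fun z => c z * g z) volume := fun hc hg => by
    rw [← locallyIntegrableOn_univ] at hg ⊢
    exact hg.continuousOn_mul hc.continuousOn isOpen_univ.isLocallyClosed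
  refine ⟨hmul hχ'.continuous W.locallyIntegrable,
    (hmul hχ'.continuous W.locallyIntegrable_deriv).add (hmul hd W.locallyIntegrable), ?_⟩
  intro θ hθ hθc
  have hpd : ∀ z, partialDeriv k (fun z => θ z * (χ z : ℂ)) z
      = partialDeriv k θ z * (χ z : ℂ) + θ z * ((partialDeriv k χ z : ℝ) : ℂ) := by
    intro z
    have h1 := (hθ.differentiable (by simp) z).hasFDerivAt
    have h2 := Complex.ofRealCLM.hasFDerivAt.comp z (hχ.differentiable (by simp) z).hasFDerivAt
    have h3 := h1.mul h2
    rw [partialDeriv, show fderiv ℝ (fun z => θ z * (χ z : ℂ)) z = _ from h3.fderiv]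
    simp [partialDeriv]
    ring
  have e := W.integral_eq (fun z => θ z * (χ z : ℂ)) (hθ.mul hχ') hθc.mul_right
  have i1 : Integrable (fun z => partialDeriv k θ z * ((χ z : ℂ) * f z)) volume :=
    integrable_test_mul (hmul hχ'.continuous W.locallyIntegrable) (continuous_partialDeriv hθ)
      (hasCompactSupport_partialDeriv hθc)
  have i2 : Integrable (fun z => θ z * (((partialDeriv k χ z : ℝ) : ℂ) * f z)) volume :=
    integrable_test_mul (hmul hd W.locallyIntegrable) hθ.continuous hθc
  have i3 : Integrable (fun z => θ z * ((χ z : ℂ) * h z)) volume :=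
    integrable_test_mul (hmul hχ'.continuous W.locallyIntegrable_deriv) hθ.continuous hθc
  have e1 : ∫ z, partialDeriv k (fun z => θ z * (χ z : ℂ)) z * f z
      = (∫ z, partialDeriv k θ z * ((χ z : ℂ) * f z))
        + ∫ z, θ z * (((partialDeriv k χ z : ℝ) : ℂ) * f z) := by
    rw [← integral_add i1 i2]
    congr 1
    ext z
    rw [hpd]
    ring
  have e2 : ∫ z, θ z * ((χ z : ℂ) * h z + ((partialDeriv k χ z : ℝ) : ℂ) * f z)
      = (∫ z, θ z * ((χ z : ℂ) * h z)) + ∫ z, θ z * (((partialDeriv k χ z : ℝ) : ℂ) * f z) := by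
    rw [← integral_add i3 i2]
    congr 1
    ext z
    ring
  rw [e2, eq_sub_of_add_eq (e1.symm.trans e)]
  simp only [mul_assoc]
  ring

end WeakDerivatives

/-! ### Compactness of Hilbert–Schmidt operators. -/

section HilbertSchmidt

variable {α 𝕜 H : Type*} [MeasurableSpace α] {μ : Measure α} [RCLike 𝕜] [NormedAddCommGroup H]
  [NormedSpace 𝕜 H]

variable (μ) in
/-- The Hilbert–Schmidt operator `f ↦ (z ↦ Φ z f)` of a square integrable family `Φ` of
functionals, as a continuous linear function of `Φ`. -/
def hilbertSchmidt : Lp (H →L[𝕜] 𝕜) 2 μ →L[𝕜] H →L[𝕜] Lp 𝕜 2 μ :=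
  (ContinuousLinearMap.compLpL₂ 2 μ (ContinuousLinearMap.apply 𝕜 𝕜 (E := H))).flip

theorem coeFn_hilbertSchmidt (Φ : Lp (H →L[𝕜] 𝕜) 2 μ) (f : H) :
    hilbertSchmidt μ Φ f =ᵐ[μ] fun z => Φ z f :=
  (ContinuousLinearMap.apply 𝕜 𝕜 f).coeFn_compLp Φ

/-- An indicator times a fixed functional gives a rank-one operator. Sums of these are dense among
the kernels, and compact operators form a closed set. -/
theorem isCompactOperator_hilbertSchmidt (Φ : Lp (H →L[𝕜] 𝕜) 2 μ) :
    IsCompactOperator (hilbertSchmidt μ Φ) := by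
  refine Lp.induction (by norm_num) (fun Φ => IsCompactOperator (hilbertSchmidt μ Φ)) ?_ ?_ ?_ Φ
  · intro c s hs hμs
    have h : hilbertSchmidt μ (Lp.simpleFunc.indicatorConst 2 hs hμs.ne c : Lp (H →L[𝕜] 𝕜) 2 μ)
        = (ContinuousLinearMap.toSpanSingleton 𝕜 (indicatorConstLp 2 hs hμs.ne (1 : 𝕜))) ∘L c := by
      ext1 f
      refine Lp.ext ?_
      rw [Lp.simpleFunc.coe_indicatorConst]
      filter_upwards [coeFn_hilbertSchmidt (indicatorConstLp 2 hs hμs.ne c) f,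
        indicatorConstLp_coeFn (p := 2) (hs := hs) (hμs := hμs.ne) (c := c),
        indicatorConstLp_coeFn (p := 2) (hs := hs) (hμs := hμs.ne) (c := (1 : 𝕜)),
        Lp.coeFn_smul (c f) (indicatorConstLp 2 hs hμs.ne (1 : 𝕜))] with z h1 h2 h3 h4
      rw [h1, h2, ContinuousLinearMap.comp_apply, ContinuousLinearMap.toSpanSingleton_apply, h4,
        Pi.smul_apply, h3]
      by_cases hz : z ∈ s <;> simp [hz]
    rw [h]
    have hc : IsCompactOperator c := isCompactOperator_of_locallyCompactSpace_dom c
    rw [ContinuousLinearMap.coe_comp]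
    exact hc.clm_comp _
  · intro f g hf hg _ hf' hg'
    rw [map_add]
    exact hf'.add hg'
  · exact IsClosed.preimage (hilbertSchmidt μ).continuous
      (isClosed_setOfPred_isCompactOperator (𝕜₁ := 𝕜) (𝕜₂ := 𝕜) (σ₁₂ := RingHom.id 𝕜))

end HilbertSchmidt

/-! ### Compactness of localized mollification, and Rellich's theorem. -/

section Mollifier

variable {n : ℕ}

theorem memLp_bump (ρ : ContDiffBump (0 : Cn n)) :
    MemLp (fun w => (ρ.normed volume w : ℂ)) 2 (volume : Measure (Cn n)) :=
  (Complex.continuous_ofReal.comp ρ.continuous_normed).memLp_of_hasCompactSupport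
    (ρ.hasCompactSupport_normed.comp_left (g := fun x : ℝ => (x : ℂ)) Complex.ofReal_zero)

/-- The function `w ↦ ρ (z - w)` as an element of `L²(ℂⁿ)`. -/
def reflectedBump (ρ : ContDiffBump (0 : Cn n)) (z : Cn n) : L2 n :=
  Lp.compMeasurePreserving (fun w => z - w) (Measure.measurePreserving_sub_left volume z)
    ((memLp_bump ρ).toLp _)

theorem coeFn_reflectedBump (ρ : ContDiffBump (0 : Cn n)) (z : Cn n) :
    reflectedBump ρ z =ᵐ[volume] fun w => (ρ.normed volume (z - w) : ℂ) :=
  (Lp.coeFn_compMeasurePreserving _ (Measure.measurePreserving_sub_left volume z)).trans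
    ((Measure.measurePreserving_sub_left volume z).quasiMeasurePreserving.ae_eq_comp
      (memLp_bump ρ).coeFn_toLp)

theorem continuous_reflectedBump (ρ : ContDiffBump (0 : Cn n)) : Continuous (reflectedBump ρ) :=
  Continuous.compMeasurePreservingLp (f := fun _ => (memLp_bump ρ).toLp _) continuous_const
    (g := fun z : Cn n => (⟨fun w => z - w, by fun_prop⟩ : C(Cn n, Cn n)))
    (ContinuousMap.curry ⟨fun p : Cn n × Cn n => p.1 - p.2, by fun_prop⟩).continuous
    (fun z => Measure.measurePreserving_sub_left volume z) (by norm_num)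

/-- Exhibits mollification as an operator with kernel z ↦ ρ(z - ·); the bump is real, so conjugation
in the first slot is harmless. -/
theorem inner_reflectedBump (ρ : ContDiffBump (0 : Cn n)) (z : Cn n) (f : L2 n) :
    ⟪reflectedBump ρ z, f⟫_ℂ = mollify volume ρ f z := by
  rw [L2.inner_def, mollify, convolution_eq_swap]
  refine integral_congr_ae ?_
  filter_upwards [coeFn_reflectedBump ρ z] with w hw
  rw [hw]
  simp [mul_comm]

/-- All the kernels ρ(z - ·) have the same L² norm, and a ball has finite measure. -/
theorem memLp_indicator_reflectedBump (ρ : ContDiffBump (0 : Cn n)) (R : ℝ) :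
    MemLp ((Metric.closedBall 0 R).indicator fun z => innerSL ℂ (reflectedBump ρ z)) 2
      (volume : Measure (Cn n)) := by
  have hs : MeasurableSet (Metric.closedBall (0 : Cn n) R) := measurableSet_closedBall
  refine (memLp_indicator_iff_restrict (f := fun z => innerSL ℂ (reflectedBump ρ z)) hs).2 ?_
  have : IsFiniteMeasure ((volume : Measure (Cn n)).restrict (Metric.closedBall 0 R)) :=
    ⟨by simpa using measure_closedBall_lt_top⟩
  refine MemLp.of_bound
    ((innerSL ℂ).continuous.comp (continuous_reflectedBump ρ)).aestronglyMeasurable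
    ‖(memLp_bump ρ).toLp _‖ (Eventually.of_forall fun z => ?_)
  rw [innerSL_apply_norm, reflectedBump, Lp.norm_compMeasurePreserving]

/-- Mollification followed by restriction to a ball is a compact operator on `L²(ℂⁿ)`. -/
theorem exists_compact_mollify (ρ : ContDiffBump (0 : Cn n)) (R : ℝ) :
    ∃ T : L2 n →L[ℂ] L2 n, IsCompactOperator T ∧
      ∀ f, T f =ᵐ[volume] (Metric.closedBall 0 R).indicator (mollify volume ρ f) := by
  refine ⟨_, isCompactOperator_hilbertSchmidt ((memLp_indicator_reflectedBump ρ R).toLp _),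
    fun f => (coeFn_hilbertSchmidt _ f).trans ?_⟩
  filter_upwards [(memLp_indicator_reflectedBump ρ R).coeFn_toLp] with z hz
  rw [hz]
  by_cases h : z ∈ Metric.closedBall 0 R
  · simp only [Set.indicator_of_mem h, innerSL_apply_apply, inner_reflectedBump]
  · simp [Set.indicator_of_notMem h]

/-- Since `G` vanishes off the ball, discarding the mollified values there only removes error. -/
theorem norm_indicator_mollify_sub_le {ρ : ContDiffBump (0 : Cn n)} {R : ℝ} {G F : L2 n}
    (hG : ∀ᵐ z, z ∉ Metric.closedBall 0 R → G z = 0)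
    (hF : F =ᵐ[volume] (Metric.closedBall 0 R).indicator (mollify volume ρ G)) :
    ‖F - G‖ ≤ ‖mollifyLp ρ G - G‖ := by
  refine Lp.norm_le_norm_of_ae_le ?_
  filter_upwards [hG, hF, coeFn_mollifyLp ρ G, Lp.coeFn_sub F G,
    Lp.coeFn_sub (mollifyLp ρ G) G] with z h1 h2 h3 h4 h5
  rw [h4, h5, Pi.sub_apply, Pi.sub_apply, h2, h3]
  by_cases h : z ∈ Metric.closedBall 0 R
  · rw [Set.indicator_of_mem h]
  · rw [Set.indicator_of_notMem h, h1 h]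
    simp

/-- **Rellich's theorem**: a family of functions supported in a fixed ball that is bounded in the
Sobolev space `H¹` is totally bounded in `L²(ℂⁿ)`. -/
theorem totallyBounded_of_weakDeriv_bounded (R C : ℝ) :
    TotallyBounded {G : L2 n | ‖G‖ ≤ C ∧ (∀ᵐ z, z ∉ Metric.closedBall 0 R → G z = 0) ∧
      ∃ H : Fin n ⊕ Fin n → L2 n, (∀ k, HasWeakPartialDeriv k G (H k)) ∧ ∑ k, ‖H k‖ ≤ C} := by
  refine Metric.totallyBounded_iff.2 fun ε hε => ?_
  have hD : 0 < |C| + 1 := by positivity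
  -- The outer radius times the H¹ bound `C` is at most ε/2; `|C| + 1` keeps the radius positive
  -- whatever the sign of `C`.
  let ρ : ContDiffBump (0 : Cn n) := ⟨ε / (2 * (|C| + 1)) / 2, ε / (2 * (|C| + 1)),
    by positivity, half_lt_self (by positivity)⟩
  obtain ⟨T, hT, hTf⟩ := exists_compact_mollify ρ R
  have htb : TotallyBounded (T '' Metric.closedBall 0 C) :=
    (hT.isCompact_closure_image_closedBall (f := (T : L2 n →ₗ[ℂ] L2 n)) C).totallyBounded.subset
      subset_closure
  obtain ⟨t, ht, htc⟩ := Metric.totallyBounded_iff.1 htb (ε / 2) (half_pos hε)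
  refine ⟨t, ht, ?_⟩
  rintro G ⟨hGC, hGs, H, hH, hHC⟩
  have hTG := htc ⟨G, by simpa using hGC, rfl⟩
  simp only [Set.mem_iUnion, Metric.mem_ball] at hTG ⊢
  obtain ⟨y, hy, hyd⟩ := hTG
  refine ⟨y, hy, ?_⟩
  have h1 : ‖T G - G‖ ≤ ε / 2 := by
    refine (norm_indicator_mollify_sub_le hGs (hTf G)).trans
      ((norm_mollifyLp_sub_le_mul hH ρ).trans ?_)
    calc ρ.rOut * ∑ k, ‖H k‖ ≤ ε / (2 * (|C| + 1)) * (|C| + 1) := by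
          refine mul_le_mul_of_nonneg_left ?_ (by positivity)
          exact hHC.trans ((le_abs_self C).trans (by linarith))
      _ = ε / 2 := by field_simp
  calc dist G y ≤ dist G (T G) + dist (T G) y := dist_triangle _ _ _
    _ < ε / 2 + ε / 2 := by
        refine add_lt_add_of_le_of_lt ?_ hyd
        rw [dist_comm, dist_eq_norm]
        exact h1
    _ = ε := add_halves ε

end Mollifier

/-! ### The Laplacian in the real coordinates. -/

section Laplacian

variable {n : ℕ}

theorem orthonormal_dir : Orthonormal ℝ (dir : Fin n ⊕ Fin n → Cn n) := by
  rw [orthonormal_iff_ite]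
  rintro (i | i) (j | j) <;>
    simp [dir, PiLp.inner_apply, Complex.inner, apply_ite, eq_comm]

theorem norm_dir (k : Fin n ⊕ Fin n) : ‖(dir k : Cn n)‖ = 1 := orthonormal_dir.1 k

/-- The real coordinate directions as a real orthonormal basis of `ℂⁿ`. -/
def dirBasis (n : ℕ) : OrthonormalBasis (Fin n ⊕ Fin n) ℝ (Cn n) :=
  OrthonormalBasis.mk orthonormal_dir fun t _ => by
    rw [← sum_realCoord_smul_dir t]
    exact Submodule.sum_mem _ fun k _ => Submodule.smul_mem _ _ (Submodule.subset_span ⟨k, rfl⟩)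

theorem contDiff_partialDeriv {φ : Cn n → ℝ} (hφ : ContDiff ℝ 2 φ) (k : Fin n ⊕ Fin n) :
    ContDiff ℝ 1 (partialDeriv k φ) :=
  (hφ.fderiv_right (m := 1) (by norm_num)).clm_apply contDiff_const

theorem laplacian_eq_sum_partialDeriv {φ : Cn n → ℝ} (hφ : ContDiff ℝ 2 φ) (z : Cn n) :
    Laplacian.laplacian φ z = ∑ k, partialDeriv k (partialDeriv k φ) z := by
  rw [InnerProductSpace.laplacian_eq_iteratedFDeriv_orthonormalBasis φ (dirBasis n)]
  refine Finset.sum_congr rfl fun k _ => ?_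
  have hd : DifferentiableAt ℝ (fderiv ℝ φ) z :=
    (hφ.fderiv_right (m := 1) (by norm_num)).differentiable (by simp) z
  have h : fderiv ℝ (fun w => fderiv ℝ φ w (dir k)) z
      = (fderiv ℝ (fderiv ℝ φ) z).flip (dir k) := by
    rw [fderiv_clm_apply hd (differentiableAt_const _)]
    simp
  rw [iteratedFDeriv_two_apply]
  simp only [dirBasis, OrthonormalBasis.coe_mk]
  change _ = fderiv ℝ (fun w => fderiv ℝ φ w (dir k)) z (dir k)
  rw [h]
  rfl

end Laplacian

/-! ### The weighted inequality in one coordinate direction. -/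

section WeightedInequality

variable {n : ℕ} {G : L2 n} {H : Fin n ⊕ Fin n → L2 n}

theorem integrable_mul_inner {b : Cn n → ℝ} (hb : Continuous b) (hc : HasCompactSupport b)
    (f g : L2 n) : Integrable (fun z => b z * ⟪f z, g z⟫_ℝ) volume := by
  refine (L2.integrable_inner (𝕜 := ℝ) (mulL b hb hc f) g).congr ?_
  filter_upwards [coeFn_mulL hb hc f] with z h
  rw [h, ← Complex.real_smul, real_inner_smul_left]

theorem norm_sq_mulL {b : Cn n → ℝ} (hb : Continuous b) (hc : HasCompactSupport b) (f : L2 n) :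
    ‖mulL b hb hc f‖ ^ 2 = ∫ z, b z ^ 2 * ⟪f z, f z⟫_ℝ := by
  rw [← real_inner_self_eq_norm_sq, L2.inner_def]
  refine integral_congr_ae ?_
  filter_upwards [coeFn_mulL hb hc f] with z h
  rw [h, ← Complex.real_smul, real_inner_smul_left, real_inner_smul_right]
  ring

/-- Right side minus left side is ‖(1+ε)s + 2εx‖²/ε. It is used with x = bG and s = ∂G - bG; the
constant is (1+ε)²/ε. -/
theorem four_mul_norm_sq_le {V : Type*} [NormedAddCommGroup V] [InnerProductSpace ℝ V] {ε : ℝ}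
    (hε : 0 < ε) (x s : V) :
    4 * ‖x‖ ^ 2 - (1 + ε) * (4 * ⟪x, s + x⟫_ℝ) ≤ (2 + ε + 1 / ε) * ‖s‖ ^ 2 := by
  have h := sq_nonneg ‖(1 + ε) • s + (2 * ε) • x‖
  have h1 : 0 ≤ ‖(1 + ε) • s + (2 * ε) • x‖ ^ 2 / ε := by positivity
  rw [norm_add_sq_real, norm_smul, norm_smul, real_inner_smul_left, real_inner_smul_right,
    mul_pow, mul_pow, Real.norm_eq_abs, Real.norm_eq_abs, sq_abs, sq_abs] at h1
  rw [inner_add_right, real_inner_self_eq_norm_sq, real_inner_comm]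
  have h2 : ((1 + ε) ^ 2 * ‖s‖ ^ 2 + 2 * ((1 + ε) * (2 * ε * ⟪s, x⟫_ℝ))
      + (2 * ε) ^ 2 * ‖x‖ ^ 2) / ε
      = (2 + ε + 1 / ε) * ‖s‖ ^ 2 + 4 * (1 + ε) * ⟪s, x⟫_ℝ + 4 * ε * ‖x‖ ^ 2 := by
    field_simp
    ring
  rw [h2] at h1
  linarith

theorem integrable_weight (G : L2 n) (ε : ℝ) {b : Cn n → ℝ} (hb : ContDiff ℝ 1 b)
    (hc : HasCompactSupport b) (k : Fin n ⊕ Fin n) :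
    Integrable (fun z => (4 * b z ^ 2 + 2 * (1 + ε) * partialDeriv k b z) * ⟪G z, G z⟫_ℝ)
      volume := by
  have h1 : HasCompactSupport fun z => 4 * b z ^ 2 :=
    hc.comp_left (g := fun x => 4 * x ^ 2) (by simp)
  have h2 : HasCompactSupport fun z => 2 * (1 + ε) * partialDeriv k b z :=
    HasCompactSupport.mul_left (f := fun _ => 2 * (1 + ε)) (hc.fderiv_apply ℝ (dir k))
  exact integrable_mul_inner ((continuous_const.mul (hb.continuous.pow 2)).add
    (continuous_const.mul (continuous_fderiv_apply_const hb (dir k)))) (h1.add h2) G G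

/-- The coercivity estimate in one direction, for compactly supported coefficients. -/
theorem integral_weight_le (hGH : ∀ k, HasWeakPartialDeriv k G (H k)) {ε : ℝ} (hε : 0 < ε)
    {b : Cn n → ℝ} (hb : ContDiff ℝ 1 b) (hc : HasCompactSupport b) (k : Fin n ⊕ Fin n) :
    ∫ z, (4 * b z ^ 2 + 2 * (1 + ε) * partialDeriv k b z) * ⟪G z, G z⟫_ℝ
      ≤ (2 + ε + 1 / ε) * ‖H k - mulL b hb.continuous hc G‖ ^ 2 := by
  have hb' : Continuous (partialDeriv k b) := continuous_fderiv_apply_const hb (dir k)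
  have hc' : HasCompactSupport (partialDeriv k b) := hc.fderiv_apply ℝ (dir k)
  have hc2 : HasCompactSupport fun z => b z ^ 2 := hc.comp_left (g := fun x => x ^ 2) (by simp)
  have h := four_mul_norm_sq_le hε (mulL b hb.continuous hc G)
    (H k - mulL b hb.continuous hc G)
  rw [sub_add_cancel, norm_sq_mulL, inner_mulL] at h
  have e := two_mul_integral_inner_weakDeriv hGH hb hc k
  have e1 : ∫ z, (4 * b z ^ 2 + 2 * (1 + ε) * partialDeriv k b z) * ⟪G z, G z⟫_ℝ
      = 4 * (∫ z, b z ^ 2 * ⟪G z, G z⟫_ℝ)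
        + 2 * (1 + ε) * ∫ z, partialDeriv k b z * ⟪G z, G z⟫_ℝ := by
    rw [← integral_const_mul, ← integral_const_mul, ← integral_add
      ((integrable_mul_inner (b := fun z => b z ^ 2) (hb.continuous.pow 2) hc2 G G).const_mul _)
      ((integrable_mul_inner hb' hc' G G).const_mul _)]
    congr 1
    ext z
    ring
  rw [e1]
  refine le_trans (le_of_eq ?_) h
  linear_combination (2 * (1 + ε)) * e

end WeightedInequality

/-! ### Smooth cutoffs at scale R. -/

section Cutoff

variable {n : ℕ}

/-- A fixed smooth bump function, equal to `1` on the unit ball. -/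
def unitBump (n : ℕ) : ContDiffBump (0 : Cn n) := ⟨1, 2, one_pos, one_lt_two⟩

/-- The smooth cutoff function `z ↦ χ (z / R)`. -/
def cutoff (n : ℕ) (R : ℝ) (z : Cn n) : ℝ := unitBump n (R⁻¹ • z)

theorem contDiff_cutoff (R : ℝ) : ContDiff ℝ ∞ (cutoff n R) :=
  (unitBump n).contDiff.comp (contDiff_id.const_smul R⁻¹)

theorem cutoff_nonneg (R : ℝ) (z : Cn n) : 0 ≤ cutoff n R z := (unitBump n).nonneg

theorem cutoff_le_one (R : ℝ) (z : Cn n) : cutoff n R z ≤ 1 := (unitBump n).le_one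

theorem abs_cutoff_le_one (R : ℝ) (z : Cn n) : |cutoff n R z| ≤ 1 := by
  rw [abs_of_nonneg (cutoff_nonneg R z)]
  exact cutoff_le_one R z

theorem cutoff_eq_one {R : ℝ} (hR : 0 < R) {z : Cn n} (hz : ‖z‖ ≤ R) : cutoff n R z = 1 := by
  refine (unitBump n).one_of_mem_closedBall ?_
  rw [mem_closedBall_zero_iff, norm_smul, norm_inv, Real.norm_of_nonneg hR.le]
  exact inv_mul_le_one_of_le₀ hz hR.le

theorem norm_lt_of_cutoff_ne_zero {R : ℝ} (hR : 0 < R) {z : Cn n} (hz : cutoff n R z ≠ 0) :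
    ‖z‖ < 2 * R := by
  have h : R⁻¹ • z ∈ Function.support (unitBump n) := hz
  rw [(unitBump n).support_eq, mem_ball_zero_iff, norm_smul, norm_inv,
    Real.norm_of_nonneg hR.le] at h
  have h2 : R⁻¹ * ‖z‖ < 2 := h
  rw [inv_mul_lt_iff₀ hR] at h2
  linarith

theorem hasCompactSupport_cutoff {R : ℝ} (hR : 0 < R) : HasCompactSupport (cutoff n R) := by
  refine HasCompactSupport.intro (isCompact_closedBall 0 (2 * R)) fun z hz => ?_
  by_contra h
  exact hz (by simpa using (norm_lt_of_cutoff_ne_zero hR h).le)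

/-- The chain rule contributes a factor R⁻¹ ≤ 1. Uniformity in R is what later allows the cutoff to
be removed. -/
theorem exists_abs_partialDeriv_cutoff_le (n : ℕ) :
    ∃ D, 0 ≤ D ∧ ∀ R, 1 ≤ R → ∀ k z, |partialDeriv k (cutoff n R) z| ≤ D := by
  obtain ⟨D, hD⟩ := ((unitBump n).hasCompactSupport.fderiv ℝ).exists_bound_of_continuous
    ((unitBump n).contDiff (n := 1) |>.continuous_fderiv (by simp))
  refine ⟨D, (norm_nonneg _).trans (hD 0), fun R hR k z => ?_⟩
  have h1 : HasFDerivAt (fun z : Cn n => R⁻¹ • z) (R⁻¹ • ContinuousLinearMap.id ℝ (Cn n)) z :=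
    (hasFDerivAt_id z).const_smul R⁻¹
  have h2 : HasFDerivAt (unitBump n) (fderiv ℝ (unitBump n) (R⁻¹ • z)) (R⁻¹ • z) :=
    ((unitBump n).contDiff (n := 1) |>.differentiable (by simp) _).hasFDerivAt
  rw [partialDeriv, show fderiv ℝ (cutoff n R) z = _ from (h2.comp z h1).fderiv]
  simp only [ContinuousLinearMap.comp_smul, ContinuousLinearMap.comp_id,
    smul_apply, smul_eq_mul, abs_mul]
  have hRi : |R⁻¹| ≤ 1 := by
    rw [abs_of_nonneg (by positivity)]
    exact inv_le_one_of_one_le₀ hR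
  have h3 : |fderiv ℝ (unitBump n) (R⁻¹ • z) (dir k)| ≤ D := by
    have := (fderiv ℝ (unitBump n) (R⁻¹ • z)).le_opNorm (dir k)
    rw [norm_dir, mul_one] at this
    exact this.trans (hD _)
  calc |R⁻¹| * |fderiv ℝ (unitBump n) (R⁻¹ • z) (dir k)| ≤ 1 * D := by gcongr
    _ = D := one_mul D

end Cutoff

/-! ### Uniform tails, local bounds and total boundedness. -/

section Main

variable {n : ℕ} {φ : Cn n → ℝ} {η : ℝ}

theorem W1.norm_toL2_le (f : W1 φ η) : ‖W1.toL2 f‖ ≤ ‖f‖ := by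
  rw [W1.norm_eq]
  exact Real.le_sqrt_of_sq_le (le_add_of_nonneg_right (by positivity))

theorem W1.norm_twistedDeriv_le (f : W1 φ η) (k : Fin n ⊕ Fin n) :
    ‖W1.twistedDeriv k f‖ ≤ ‖f‖ := by
  rw [W1.norm_eq]
  refine Real.le_sqrt_of_sq_le ?_
  have := Finset.single_le_sum (f := fun k => ‖W1.twistedDeriv k f‖ ^ 2)
    (fun _ _ => by positivity) (Finset.mem_univ k)
  nlinarith [sq_nonneg ‖W1.toL2 f‖]

/-- The potential `(η / 2) ∂ₖ φ`. -/
def potential (φ : Cn n → ℝ) (η : ℝ) (k : Fin n ⊕ Fin n) (z : Cn n) : ℝ :=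
  η / 2 * partialDeriv k φ z

theorem contDiff_potential (hφ : ContDiff ℝ 2 φ) (k : Fin n ⊕ Fin n) :
    ContDiff ℝ 1 (potential φ η k) :=
  contDiff_const.mul (contDiff_partialDeriv hφ k)

variable {χ : Cn n → ℝ} (hχ : ContDiff ℝ ∞ χ) (hχc : HasCompactSupport χ)

theorem continuous_partialDeriv_real (hχ : ContDiff ℝ ∞ χ) (k : Fin n ⊕ Fin n) :
    Continuous (partialDeriv k χ) :=
  continuous_fderiv_apply_const (hχ.of_le (by simp)) (dir k)

theorem hasCompactSupport_partialDeriv_real (hχc : HasCompactSupport χ) (k : Fin n ⊕ Fin n) :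
    HasCompactSupport (partialDeriv k χ) :=
  hχc.fderiv_apply ℝ (dir k)

/-- The part `χ (∂ₖ f - a f) + (∂ₖ χ) f` of the derivative of `χ f`. -/
def localizedTwistedDeriv (f : W1 φ η) (k : Fin n ⊕ Fin n) : L2 n :=
  mulL χ hχ.continuous hχc (W1.twistedDeriv k f)
    + mulL (partialDeriv k χ) (continuous_partialDeriv_real hχ k)
      (hasCompactSupport_partialDeriv_real hχc k) (W1.toL2 f)

/-- By the Leibniz rule, splitting ∂f into its twisted part and af; the term χaf is kept apart
because it is what the coercivity estimate subtracts. -/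
theorem hasWeakPartialDeriv_mulL (hφ : ContDiff ℝ 2 φ) (f : W1 φ η) (k : Fin n ⊕ Fin n) :
    HasWeakPartialDeriv k (mulL χ hχ.continuous hχc (W1.toL2 f))
      (localizedTwistedDeriv hχ hχc f k
        + mulL (fun z => χ z * potential φ η k z)
          (hχ.continuous.mul (contDiff_potential hφ k).continuous) hχc.mul_right (W1.toL2 f) :
        L2 n) := by
  refine ((W1.hasTwistedDeriv f k).smooth_mul hχ).congr
    (coeFn_mulL hχ.continuous hχc _).symm ?_
  have hp := hχ.continuous.mul (contDiff_potential (η := η) hφ k).continuous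
  filter_upwards [
    Lp.coeFn_add (localizedTwistedDeriv hχ hχc f k)
      (mulL (fun z => χ z * potential φ η k z) hp hχc.mul_right (W1.toL2 f)),
    Lp.coeFn_add (mulL χ hχ.continuous hχc (W1.twistedDeriv k f))
      (mulL (partialDeriv k χ) (continuous_partialDeriv_real hχ k)
        (hasCompactSupport_partialDeriv_real hχc k) (W1.toL2 f)),
    coeFn_mulL (b := fun z => χ z * potential φ η k z) hp hχc.mul_right (W1.toL2 f),
    coeFn_mulL hχ.continuous hχc (W1.twistedDeriv k f),
    coeFn_mulL (continuous_partialDeriv_real hχ k)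
      (hasCompactSupport_partialDeriv_real hχc k) (W1.toL2 f)] with z h1 h2 h3 h4 h5
  rw [h1, Pi.add_apply, localizedTwistedDeriv, h2, Pi.add_apply, h3, h4, h5, potential]
  push_cast
  ring

theorem norm_localizedTwistedDeriv_le (h1 : ∀ z, |χ z| ≤ 1) {D : ℝ}
    (hD : ∀ k z, |partialDeriv k χ z| ≤ D) (f : W1 φ η) (k : Fin n ⊕ Fin n) (hf : ‖f‖ ≤ 1)
    (hD0 : 0 ≤ D) : ‖localizedTwistedDeriv hχ hχc f k‖ ≤ 1 + D := by
  refine (norm_add_le _ _).trans (add_le_add ?_ ?_)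
  · refine (norm_mulL_le _ _ h1 _).trans ?_
    rw [one_mul]
    exact (W1.norm_twistedDeriv_le f k).trans hf
  · refine (norm_mulL_le _ _ (hD k) _).trans ?_
    exact mul_le_of_le_one_right hD0 ((W1.norm_toL2_le f).trans hf)

/-- The function `η² |∇φ|² + (1 + ε) η △φ`. -/
def weight (φ : Cn n → ℝ) (η ε : ℝ) (z : Cn n) : ℝ :=
  η ^ 2 * ∑ k, (partialDeriv k φ z) ^ 2 + (1 + ε) * η * Laplacian.laplacian φ z

theorem weight_eq (hφ : ContDiff ℝ 2 φ) (ε : ℝ) (z : Cn n) :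
    weight φ η ε z = ∑ k, (4 * potential φ η k z ^ 2
      + 2 * (1 + ε) * partialDeriv k (potential φ η k) z) := by
  have hp : ∀ k, partialDeriv k (potential φ η k) z
      = η / 2 * partialDeriv k (partialDeriv k φ) z := fun k => by
    rw [partialDeriv, show potential φ η k = fun z => η / 2 * partialDeriv k φ z from rfl,
      fderiv_const_mul ((contDiff_partialDeriv hφ k).differentiable (by simp) z)]
    rfl
  rw [weight, laplacian_eq_sum_partialDeriv hφ, Finset.mul_sum, Finset.mul_sum,
    ← Finset.sum_add_distrib]
  refine Finset.sum_congr rfl fun k _ => ?_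
  rw [hp, potential]
  ring

theorem continuous_weight (hφ : ContDiff ℝ 2 φ) (ε : ℝ) : Continuous (weight φ η ε) := by
  rw [show weight φ η ε = _ from funext (weight_eq hφ ε)]
  refine continuous_finsetSum _ fun k _ => ?_
  have h := contDiff_potential (η := η) hφ k
  exact (continuous_const.mul (h.continuous.pow 2)).add
    (continuous_const.mul (continuous_fderiv_apply_const h (dir k)))

/-- The coercivity estimate: `∫ (η² |∇φ|² + (1 + ε) η △φ) |χ f|²` is controlled by the twisted
derivatives of `χ f`. -/
theorem integral_weight_mul_le (hφ : ContDiff ℝ 2 φ) {ε : ℝ} (hε : 0 < ε) (f : W1 φ η)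
    {θ : Cn n → ℝ} (hθ : ContDiff ℝ ∞ θ) (hθc : HasCompactSupport θ)
    (hθχ : ∀ z, χ z ≠ 0 → θ =ᶠ[𝓝 z] fun _ => 1) :
    Integrable (fun z => weight φ η ε z * ⟪mulL χ hχ.continuous hχc (W1.toL2 f) z,
      mulL χ hχ.continuous hχc (W1.toL2 f) z⟫_ℝ) volume ∧
    ∫ z, weight φ η ε z * ⟪mulL χ hχ.continuous hχc (W1.toL2 f) z,
      mulL χ hχ.continuous hχc (W1.toL2 f) z⟫_ℝ
      ≤ (2 + ε + 1 / ε) * ∑ k, ‖localizedTwistedDeriv hχ hχc f k‖ ^ 2 := by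
  set G : L2 n := mulL χ hχ.continuous hχc (W1.toL2 f) with hG
  -- The one-direction estimate needs compactly supported coefficients, so the potential is
  -- multiplied by `θ`, which is 1 wherever χf can be nonzero.
  have hb : ∀ k, ContDiff ℝ 1 fun z => θ z * potential φ η k z := fun k =>
    (hθ.of_le (by simp)).mul (contDiff_potential hφ k)
  have hc : ∀ k, HasCompactSupport fun z => θ z * potential φ η k z := fun k => hθc.mul_right
  have hcoe := coeFn_mulL hχ.continuous hχc (W1.toL2 f)
  have hmul : ∀ k, mulL _ (hb k).continuous (hc k) G
      = mulL (fun z => χ z * potential φ η k z)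
          (hχ.continuous.mul (contDiff_potential hφ k).continuous) hχc.mul_right (W1.toL2 f) := by
    intro k
    refine Lp.ext ?_
    filter_upwards [coeFn_mulL (hb k).continuous (hc k) G, hcoe,
      coeFn_mulL (b := fun z => χ z * potential φ η k z)
        (hχ.continuous.mul (contDiff_potential (η := η) hφ k).continuous)
        hχc.mul_right (W1.toL2 f)] with z h1 h2 h3
    rw [h1, hG, h2, h3]
    by_cases hz : χ z = 0
    · simp [hz]
    · simp only [(hθχ z hz).self_of_nhds]
      push_cast
      ring
  have hw : ∀ k, ∫ z, (4 * (θ z * potential φ η k z) ^ 2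
      + 2 * (1 + ε) * partialDeriv k (fun z => θ z * potential φ η k z) z) * ⟪G z, G z⟫_ℝ
      ≤ (2 + ε + 1 / ε) * ‖localizedTwistedDeriv hχ hχc f k‖ ^ 2 := by
    intro k
    have h := integral_weight_le (fun k => hasWeakPartialDeriv_mulL hχ hχc hφ f k) hε
      (hb k) (hc k) k
    rwa [← hG, hmul, add_sub_cancel_right] at h
  have hi : ∀ k, Integrable (fun z => (4 * (θ z * potential φ η k z) ^ 2
      + 2 * (1 + ε) * partialDeriv k (fun z => θ z * potential φ η k z) z) * ⟪G z, G z⟫_ℝ)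
      volume :=
    fun k => integrable_weight G ε (hb k) (hc k) k
  have heq : (fun z => weight φ η ε z * ⟪G z, G z⟫_ℝ) =ᵐ[volume]
      fun z => ∑ k, (4 * (θ z * potential φ η k z) ^ 2
        + 2 * (1 + ε) * partialDeriv k (fun z => θ z * potential φ η k z) z) * ⟪G z, G z⟫_ℝ := by
    filter_upwards [hcoe] with z hz
    by_cases h0 : χ z = 0
    · simp [hG, hz, h0]
    · rw [weight_eq hφ, Finset.sum_mul]
      refine Finset.sum_congr rfl fun k _ => ?_
      -- Equality on a neighbourhood, not just at z, is needed because the weight contains the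
      -- derivative of the coefficient.
      have h1 : (fun z => θ z * potential φ η k z) =ᶠ[𝓝 z] potential φ η k := by
        filter_upwards [hθχ z h0] with w hw
        rw [hw, one_mul]
      have h2 := h1.self_of_nhds
      rw [show θ z * potential φ η k z = potential φ η k z from h2, partialDeriv, partialDeriv,
        h1.fderiv_eq]
  refine ⟨(integrable_finsetSum _ fun k _ => hi k).congr heq.symm, ?_⟩
  rw [integral_congr_ae heq, integral_finsetSum _ fun k _ => hi k, Finset.mul_sum]
  exact Finset.sum_le_sum fun k _ => hw k

/-- A bound on `∫ w |G|²`, with `w` bounded below and large outside a ball, controls `G` outside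
this ball. -/
theorem mul_norm_sub_sq_le_of_weight {N M R : ℝ} (hR : 0 < R) (hM : 0 ≤ M) {w : Cn n → ℝ}
    (hwM : ∀ z, -M ≤ w z) (hwN : ∀ z, R < ‖z‖ → N ≤ w z) (G : L2 n) (hN : 0 ≤ N)
    (hi : Integrable (fun z => w z * ⟪G z, G z⟫_ℝ) volume) :
    N * ‖G - mulL (cutoff n R) (contDiff_cutoff R).continuous (hasCompactSupport_cutoff hR) G‖ ^ 2
      ≤ (∫ z, w z * ⟪G z, G z⟫_ℝ) + M * ‖G‖ ^ 2 := by
  set F := G - mulL (cutoff n R) (contDiff_cutoff R).continuous (hasCompactSupport_cutoff hR) G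
  rw [← real_inner_self_eq_norm_sq, ← real_inner_self_eq_norm_sq, L2.inner_def, L2.inner_def,
    ← integral_const_mul, ← integral_const_mul,
    ← integral_add hi ((L2.integrable_inner (𝕜 := ℝ) G G).const_mul M)]
  refine integral_mono_ae ((L2.integrable_inner (𝕜 := ℝ) F F).const_mul N)
    (hi.add ((L2.integrable_inner (𝕜 := ℝ) G G).const_mul M)) ?_
  filter_upwards [Lp.coeFn_sub G (mulL (cutoff n R) (contDiff_cutoff R).continuous
    (hasCompactSupport_cutoff hR) G), coeFn_mulL (contDiff_cutoff R).continuous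
    (hasCompactSupport_cutoff hR) G] with z h1 h2
  have hF : F z = (1 - cutoff n R z) • G z := by
    rw [h1, Pi.sub_apply, h2, sub_smul, one_smul, Complex.real_smul]
  simp only [hF, real_inner_smul_left, real_inner_smul_right]
  have hg : 0 ≤ ⟪G z, G z⟫_ℝ := real_inner_self_nonneg
  rw [← mul_assoc, ← mul_assoc, ← add_mul]
  refine mul_le_mul_of_nonneg_right ?_ hg
  -- Inside the ball the left side vanishes and `M` absorbs the negative part of `w`; outside, (1 -
  -- cutoff)² ≤ 1 and `w` is at least `N`.
  by_cases hz : ‖z‖ ≤ R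
  · rw [cutoff_eq_one hR hz]
    simp only [sub_self, mul_zero]
    linarith [hwM z]
  · have hc0 := cutoff_nonneg R z
    have hc1 := cutoff_le_one R z
    have h3 : (1 - cutoff n R z) * (1 - cutoff n R z) ≤ 1 := by nlinarith
    have h4 := mul_le_mul_of_nonneg_left h3 hN
    rw [mul_assoc]
    linarith [hwN z (not_le.1 hz)]

/-- Fatou's lemma. -/
theorem norm_le_of_tendsto_ae {F : ℕ → L2 n} {G : L2 n} {C : ℝ} (hC : 0 ≤ C)
    (hF : ∀ m, ‖F m‖ ≤ C) (h : ∀ᵐ z, Tendsto (fun m => F m z) atTop (𝓝 (G z))) : ‖G‖ ≤ C := by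
  have h1 := Lp.eLpNorm_lim_le_liminf_eLpNorm (p := 2)
    (fun m => Lp.aestronglyMeasurable (F m)) G h
  rw [Lp.norm_def]
  refine ENNReal.toReal_le_of_le_ofReal hC (h1.trans ?_)
  refine (liminf_le_liminf (Eventually.of_forall fun m => ?_)).trans
    (le_of_eq (liminf_const (f := atTop (α := ℕ)) (ENNReal.ofReal C)))
  rw [← ENNReal.ofReal_toReal (Lp.eLpNorm_ne_top (F m)), ← Lp.norm_def]
  exact ENNReal.ofReal_le_ofReal (hF m)

/-- If `η² |∇φ|² + (1 + ε) η △φ` tends to `+∞`, then the unit ball of `W¹_η` has uniformly small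
tails in `L²(ℂⁿ)`. -/
theorem exists_norm_sub_cutoff_le (hφ : ContDiff ℝ 2 φ) {ε : ℝ} (hε : 0 < ε)
    (hlim : Tendsto (weight φ η ε) (cocompact (Cn n)) atTop) {δ : ℝ} (hδ : 0 < δ) :
    ∃ (R : ℝ) (hR : 0 < R), ∀ f : W1 φ η, ‖f‖ ≤ 1 →
      ‖W1.toL2 f - mulL (cutoff n R) (contDiff_cutoff R).continuous (hasCompactSupport_cutoff hR)
        (W1.toL2 f)‖ ≤ δ := by
  obtain ⟨D, hD0, hD⟩ := exists_abs_partialDeriv_cutoff_le n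
  obtain ⟨M, hM, hwM⟩ : ∃ M, 0 ≤ M ∧ ∀ z, -M ≤ weight φ η ε z := by
    obtain ⟨z₀, hz₀⟩ := (continuous_weight hφ ε).exists_forall_le hlim
    refine ⟨|weight φ η ε z₀|, abs_nonneg _, fun z => (neg_abs_le _).trans (hz₀ z)⟩
  -- `K` bounds ∫ w|G|² + M‖G‖² for every cutoff G of radius at least 1 of every f in the unit ball.
  -- `N` is then chosen with K ≤ Nδ², and `R` so that the weight exceeds `N` beyond it.
  set K := (2 + ε + 1 / ε) * ∑ _k : Fin n ⊕ Fin n, (1 + D) ^ 2 + M with hK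
  have hK0 : 0 ≤ K := by positivity
  obtain ⟨N, hN, hKN⟩ : ∃ N, 0 < N ∧ K ≤ N * δ ^ 2 :=
    ⟨(K + 1) / δ ^ 2, by positivity, by
      rw [div_mul_cancel₀ _ (by positivity)]
      linarith⟩
  obtain ⟨R, hR, hwN⟩ : ∃ R, 0 < R ∧ ∀ z, R < ‖z‖ → N ≤ weight φ η ε z := by
    have h := hlim.eventually_ge_atTop N
    rw [← Metric.cobounded_eq_cocompact, ← comap_norm_atTop, eventually_comap,
      eventually_atTop] at h
    obtain ⟨r, hr⟩ := h
    exact ⟨max r 1, by positivity, fun z hz => hr ‖z‖ ((le_max_left _ _).trans hz.le) z rfl⟩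
  refine ⟨R, hR, fun f hf => ?_⟩
  set Q := mulL (cutoff n R) (contDiff_cutoff R).continuous (hasCompactSupport_cutoff hR) with hQ
  have hpos : ∀ m : ℕ, (0 : ℝ) < m + 1 := fun m => by positivity
  -- Coercivity is only available after cutting off, so it is applied to an exhaustion of f, with
  -- radii m + 1 ≥ 1 so that `D` applies. The bound is independent of m and passes to f by Fatou.
  set P : ℕ → L2 n := fun m => mulL (cutoff n (m + 1)) (contDiff_cutoff _).continuous
    (hasCompactSupport_cutoff (hpos m)) (W1.toL2 f) with hP
  have hPn : ∀ m, ‖P m‖ ≤ 1 := fun m => by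
    refine (norm_mulL_le _ _ (abs_cutoff_le_one _) _).trans ?_
    rw [one_mul]
    exact (W1.norm_toL2_le f).trans hf
  refine norm_le_of_tendsto_ae (F := fun m => P m - Q (P m)) hδ.le (fun m => ?_) ?_
  -- The cutoff at scale m + 1 is nonzero only in the open ball of radius 2(m + 1), where the cutoff
  -- at scale 2(m + 1) is identically 1.
  · have hθχ : ∀ z : Cn n, cutoff n ((m : ℝ) + 1) z ≠ 0 →
        cutoff n (2 * ((m : ℝ) + 1)) =ᶠ[𝓝 z] fun _ => 1 := fun z hz => by
      have h1 := norm_lt_of_cutoff_ne_zero (hpos m) hz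
      filter_upwards [(isOpen_lt continuous_norm continuous_const).mem_nhds h1] with w hw
      exact cutoff_eq_one (by have := hpos m; positivity) (le_of_lt hw)
    obtain ⟨hi, hle⟩ := integral_weight_mul_le (contDiff_cutoff ((m : ℝ) + 1))
      (hasCompactSupport_cutoff (hpos m)) hφ hε f (contDiff_cutoff (2 * ((m : ℝ) + 1)))
      (hasCompactSupport_cutoff (by have := hpos m; positivity)) hθχ
    have h2 := mul_norm_sub_sq_le_of_weight hR hM hwM hwN (P m) hN.le hi
    have h3 : ∑ k, ‖localizedTwistedDeriv (contDiff_cutoff ((m : ℝ) + 1))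
        (hasCompactSupport_cutoff (hpos m)) f k‖ ^ 2 ≤ ∑ _k : Fin n ⊕ Fin n, (1 + D) ^ 2 :=
      Finset.sum_le_sum fun k _ => by
        gcongr
        exact norm_localizedTwistedDeriv_le _ _ (abs_cutoff_le_one _)
          (hD _ (by linarith [Nat.cast_nonneg (α := ℝ) m])) f k hf hD0
    have h4 : ‖P m‖ ^ 2 ≤ 1 := pow_le_one₀ (norm_nonneg _) (hPn m)
    have h5 : N * ‖P m - Q (P m)‖ ^ 2 ≤ N * δ ^ 2 := by
      refine h2.trans (le_trans ?_ hKN)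
      rw [hK]
      refine add_le_add (hle.trans ?_) (mul_le_of_le_one_right hM h4)
      exact mul_le_mul_of_nonneg_left h3 (by positivity)
    exact le_of_sq_le_sq (le_of_mul_le_mul_left h5 hN) hδ.le
  · have hPc : ∀ᵐ z, ∀ m, P m z = (cutoff n ((m : ℝ) + 1) z : ℂ) * W1.toL2 f z :=
      ae_all_iff.2 fun m => coeFn_mulL _ _ _
    have hQP : ∀ᵐ z, ∀ m, Q (P m) z = (cutoff n R z : ℂ) * P m z :=
      ae_all_iff.2 fun m => coeFn_mulL _ _ _
    have hsub : ∀ᵐ z, ∀ m, (P m - Q (P m) : L2 n) z = P m z - Q (P m) z :=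
      ae_all_iff.2 fun m => Lp.coeFn_sub _ _
    filter_upwards [hPc, hQP, hsub, Lp.coeFn_sub (W1.toL2 f) (Q (W1.toL2 f)),
      coeFn_mulL (contDiff_cutoff R).continuous (hasCompactSupport_cutoff hR) (W1.toL2 f)]
      with z h1 h2 h3 h4 h5
    refine tendsto_const_nhds.congr' ?_
    -- At each point the sequence is eventually constant: the outer cutoff is 1 once m + 1 ≥ ‖z‖.
    filter_upwards [eventually_ge_atTop ⌈‖z‖⌉₊] with m hm
    have hmz : ‖z‖ ≤ (m : ℝ) + 1 := by
      have := (Nat.le_ceil ‖z‖).trans (Nat.cast_le.2 hm)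
      linarith
    rw [h3, h2, h1, cutoff_eq_one (hpos m) hmz, h4, Pi.sub_apply, h5]
    simp

/-- The potentials are continuous, hence bounded on the support of the cutoff. The constant may
depend on `R`, which is already fixed when Rellich is applied. -/
theorem exists_localized_bounds (hφ : ContDiff ℝ 2 φ) {R : ℝ} (hR : 0 < R) :
    ∃ C, ∀ f : W1 φ η, ‖f‖ ≤ 1 →
      ‖mulL (cutoff n R) (contDiff_cutoff R).continuous (hasCompactSupport_cutoff hR)
        (W1.toL2 f)‖ ≤ C ∧ ∃ H : Fin n ⊕ Fin n → L2 n,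
          (∀ k, HasWeakPartialDeriv k (mulL (cutoff n R) (contDiff_cutoff R).continuous
            (hasCompactSupport_cutoff hR) (W1.toL2 f)) (H k)) ∧ ∑ k, ‖H k‖ ≤ C := by
  have hχ := contDiff_cutoff (n := n) R
  have hχc := hasCompactSupport_cutoff (n := n) hR
  choose D hD0 hD using fun k => exists_abs_le (continuous_partialDeriv_real hχ k)
    (hasCompactSupport_partialDeriv_real hχc k)
  have hp : ∀ k, Continuous fun z => cutoff n R z * potential φ η k z := fun k =>
    hχ.continuous.mul (contDiff_potential hφ k).continuous
  have hpc : ∀ k, HasCompactSupport fun z => cutoff n R z * potential φ η k z := fun k =>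
    hχc.mul_right
  choose A hA0 hA using fun k => exists_abs_le (hp k) (hpc k)
  refine ⟨1 + ∑ k, (1 + D k + A k), fun f hf => ?_⟩
  have hf2 := (W1.norm_toL2_le f).trans hf
  have hs : 0 ≤ ∑ k, (1 + D k + A k) :=
    Finset.sum_nonneg fun k _ => by linarith [hD0 k, hA0 k]
  refine ⟨?_, _, fun k => hasWeakPartialDeriv_mulL hχ hχc hφ f k, ?_⟩
  · refine (norm_mulL_le _ _ (abs_cutoff_le_one R) _).trans ?_
    linarith
  · refine le_trans (Finset.sum_le_sum fun k _ => ?_) (le_add_of_nonneg_left zero_le_one)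
    refine (norm_add_le _ _).trans (add_le_add ((norm_add_le _ _).trans (add_le_add ?_ ?_)) ?_)
    · refine (norm_mulL_le _ _ (abs_cutoff_le_one R) _).trans ?_
      rw [one_mul]
      exact (W1.norm_twistedDeriv_le f k).trans hf
    · exact (norm_mulL_le _ _ (hD k) _).trans (mul_le_of_le_one_right (hD0 k) hf2)
    · exact (norm_mulL_le _ _ (hA k) _).trans (mul_le_of_le_one_right (hA0 k) hf2)

theorem totallyBounded_image_embedding (hφ : ContDiff ℝ 2 φ) {ε : ℝ} (hε : 0 < ε)
    (hlim : Tendsto (weight φ η ε) (cocompact (Cn n)) atTop) :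
    TotallyBounded (W1.embedding φ η '' Metric.closedBall 0 1) := by
  refine Metric.totallyBounded_iff.2 fun δ hδ => ?_
  obtain ⟨R, hR, hRf⟩ := exists_norm_sub_cutoff_le hφ hε hlim (half_pos hδ)
  obtain ⟨C, hC⟩ := exists_localized_bounds (η := η) hφ hR
  -- A finite δ/2-net for the localized functions is a δ-net for the image of the unit ball, since
  -- the tails cost at most δ/2.
  obtain ⟨t, ht, htc⟩ := Metric.totallyBounded_iff.1
    (totallyBounded_of_weakDeriv_bounded (n := n) (2 * R) C) (δ / 2) (half_pos hδ)
  refine ⟨t, ht, ?_⟩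
  rintro _ ⟨f, hf, rfl⟩
  have hf1 : ‖f‖ ≤ 1 := by simpa using hf
  set G := mulL (cutoff n R) (contDiff_cutoff R).continuous (hasCompactSupport_cutoff hR)
    (W1.toL2 f)
  obtain ⟨hG, H, hH, hHC⟩ := hC f hf1
  have hGs : ∀ᵐ z, z ∉ Metric.closedBall 0 (2 * R) → G z = 0 := by
    filter_upwards [coeFn_mulL (contDiff_cutoff R).continuous (hasCompactSupport_cutoff hR)
      (W1.toL2 f)] with z hz hzR
    have h0 : cutoff n R z = 0 := by
      by_contra h
      exact hzR (by simpa using (norm_lt_of_cutoff_ne_zero hR h).le)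
    rw [hz, h0]
    simp
  have hmem := htc ⟨hG, hGs, H, hH, hHC⟩
  simp only [Set.mem_iUnion, Metric.mem_ball] at hmem ⊢
  obtain ⟨y, hy, hyd⟩ := hmem
  refine ⟨y, hy, ?_⟩
  calc dist (W1.embedding φ η f) y ≤ dist (W1.toL2 f) G + dist G y := dist_triangle _ _ _
    _ < δ / 2 + δ / 2 := by
        refine add_lt_add_of_le_of_lt ?_ hyd
        rw [dist_eq_norm]
        exact hRf f hf1
    _ = δ := add_halves δ

end Main

end NablaSobolev

end

theorem mainTheorem3 (n : ℕ) (φ : NablaSobolev.Cn n → ℝ) (hφ : ContDiff ℝ 2 φ)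
    (η ε : ℝ) (hε : 0 < ε)
    (hlim : Tendsto
      (fun z => η ^ 2 * ∑ k, (NablaSobolev.partialDeriv k φ z) ^ 2
        + (1 + ε) * η * Laplacian.laplacian φ z)
      (cocompact (NablaSobolev.Cn n)) atTop) :
    IsCompactOperator (NablaSobolev.W1.embedding φ η) := by
  have h := NablaSobolev.totallyBounded_image_embedding hφ hε hlim
  refine (isCompactOperator_iff_isCompact_closure_image_closedBall
    (NablaSobolev.W1.embedding φ η : NablaSobolev.W1 φ η →ₗ[ℂ] NablaSobolev.L2 n) one_pos).2 ?_
  exact h.closure.isCompact_of_isClosed isClosed_closure
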